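/- There is a function $b:\mathbb N\to\mathbb N$ such that the following holds for every field $k$, every $n\ge 0$ and $R=k[x_1,\dots,x_n]$. Let $\varphi:M\to N$ be a morphism of $R$-modules such that the diagram $M\xrightarrow{\varphi}N$ is computed by a colimit computation of size $s$ in the category of $R$-modules, with respect to the basic morphisms listed below. Then there is a colimit computation of size at most $b(s)$ that computes the diagram $\operatorname{im}(\varphi)\hookrightarrow N$. Here the basic morphisms are $R\xrightarrow{x_i}R$ for $i=1,\dots,n$, $R\xrightarrow{c}R$ for $c\in k$, the two inclusions $i_1,i_2:R\to R\oplus R$, the diagonal $\Delta:R\to R\oplus R$, the addition $+:R\oplus R\to R$, and $R\to\{0\}$. A diagram of shape $I$, where $I$ is a directed graph, assigns to every vertex of $I$ a module and to every edge a morphism from the module at its source to the module at its target; no commutativity is required. A colimit computation is a sequence of diagrams $(D_0,\dots,D_r)$, whose shapes $I_0\subseteq\dots\subseteq I_r$ are finite directed graphs, such that (i) every edge of $D_0$ is a basic morphism and every vertex of $I_0$ is an endpoint of an edge of $I_0$; (ii) for $1\le i\le r$, $D_i$ is obtained from $D_{i-1}$ by choosing a full subgraph $J_i$ of $I_{i-1}$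 and adding one new vertex $v_i$, carrying a colimit of $D_{i-1}|_{J_i}$, together with one edge from each vertex of $J_i$ to $v_i$, carrying the corresponding morphism of the colimit cocone; (iii) (constructivity) if $v_i$ is a vertex of $J_j$ for some $j>i$, then $J_i$ is a subgraph of $J_j$. The size of the computation is $r$ plus the number of edges of $I_0$. The computation computes a diagram $D$ if $D$ is isomorphic to a (not necessarily full) subdiagram of $D_r$; a morphism $X\to Y$ is regarded as a diagram whose shape has two distinct vertices and one edge. -/

import Mathlib

open CategoryTheory

universe u v w

/-- A (not necessarily full) subgraph of a directed graph: a set of vertices together with a set of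
edges whose endpoints are among these vertices. -/
structure DiSubgraph (V : Type) [Quiver.{0} V] where
  verts : Set V
  edges : Set (Quiver.Total V)
  left_mem : ∀ e ∈ edges, e.left ∈ verts
  right_mem : ∀ e ∈ edges, e.right ∈ verts

namespace DiSubgraph

variable {V : Type} [Quiver.{0} V]

/-- `H ≤ K` means that `H` is a subgraph of `K`. -/
instance : LE (DiSubgraph V) where
  le H K := H.verts ⊆ K.verts ∧ H.edges ⊆ K.edges

/-- `H` is a full subgraph of `K`: a subgraph that contains every edge of `K` whose endpoints both
lie in `H`. -/
def IsFullIn (H K : DiSubgraph V) : Prop :=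
  H ≤ K ∧ ∀ e ∈ K.edges, e.left ∈ H.verts → e.right ∈ H.verts → e ∈ H.edges

end DiSubgraph

section Diagrams

variable {C : Type u} [Category.{v} C] {V : Type} [Quiver.{0} V]

/-- The morphisms `φ a : D a ⟶ W`, for `a` a vertex of `J`, form a cocone with vertex `W` over the
restriction of the diagram `D` to the subgraph `J`. A diagram in `C` of shape `V` is a homomorphism
of directed graphs from `V` to the underlying graph of `C`. -/
def IsCoconeOn (D : V ⥤q C) (J : DiSubgraph V) (W : C)
    (φ : ∀ a : J.verts, D.obj a.1 ⟶ W) : Prop :=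
  ∀ (e : Quiver.Total V) (he : e ∈ J.edges),
    D.map e.hom ≫ φ ⟨e.right, J.right_mem e he⟩ = φ ⟨e.left, J.left_mem e he⟩

/-- The cocone `φ` with vertex `W` is a colimit of the restriction of `D` to `J`. -/
def IsColimitOn (D : V ⥤q C) (J : DiSubgraph V) (W : C)
    (φ : ∀ a : J.verts, D.obj a.1 ⟶ W) : Prop :=
  IsCoconeOn D J W φ ∧
    ∀ (X : C) (ψ : ∀ a : J.verts, D.obj a.1 ⟶ X), IsCoconeOn D J X ψ →
      ∃! t : W ⟶ X, ∀ a : J.verts, φ a ≫ t = ψ a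

/-- The diagram `F` is isomorphic to a (not necessarily full) subdiagram of `D`. -/
def IsIsoToSubdiagram {S : Type} [Quiver.{0} S] (F : S ⥤q C) (D : V ⥤q C) : Prop :=
  ∃ g : S ⥤q V,
    Function.Injective g.obj ∧
    (∀ a b : S, Function.Injective (fun e : a ⟶ b => g.map e)) ∧
    ∃ α : ∀ a : S, F.obj a ≅ D.obj (g.obj a),
      ∀ (a b : S) (e : a ⟶ b), F.map e ≫ (α b).hom = (α a).hom ≫ D.map (g.map e)

end Diagrams

/-- A colimit computation `(D₀, …, Dₛ)` in `C` with basic morphisms `A`. Since each `Dᵢ` is the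
restriction of `Dₛ` to the shape `Iᵢ` of `Dᵢ`, the computation is recorded by the last diagram `Dₛ`
(of shape `V`) together with the increasing sequence of subgraphs `I₀, …, Iₛ` of `V`. -/
structure ColimitComputation {C : Type u} [Category.{v} C] (A : MorphismProperty C) where
  /-- the vertices of the shape of the last diagram -/
  V : Type
  [quiver : Quiver.{0} V]
  [finite_verts : Finite V]
  [finite_edges : Finite (Quiver.Total V)]
  /-- the last diagram `Dₛ` -/
  diagram : V ⥤q C
  /-- the number `s` of colimit steps -/
  steps : ℕ
  /-- the shapes `I₀, …, Iₛ` -/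
  shape : Fin (steps + 1) → DiSubgraph V
  shape_last_verts : (shape (Fin.last steps)).verts = Set.univ
  shape_last_edges : (shape (Fin.last steps)).edges = Set.univ
  /-- every edge of `D₀` is a basic morphism -/
  basic : ∀ e ∈ (shape 0).edges, A (diagram.map e.hom)
  /-- `D₀` consists of basic morphisms only: it has no isolated vertices -/
  no_isolated : ∀ a ∈ (shape 0).verts, ∃ e ∈ (shape 0).edges, e.left = a ∨ e.right = a
  /-- the shape of the subdiagram whose colimit is added in the given step -/
  sub : Fin steps → DiSubgraph V
  sub_full : ∀ i : Fin steps, (sub i).IsFullIn (shape i.castSucc)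
  /-- the vertex added in the given step -/
  apex : Fin steps → V
  apex_new : ∀ i : Fin steps, apex i ∉ (shape i.castSucc).verts
  /-- the edges (cocone morphisms) added in the given step -/
  leg : ∀ (i : Fin steps) (a : (sub i).verts), a.1 ⟶ apex i
  verts_succ : ∀ i : Fin steps,
    (shape i.succ).verts = insert (apex i) (shape i.castSucc).verts
  edges_succ : ∀ i : Fin steps,
    (shape i.succ).edges = (shape i.castSucc).edges ∪
      Set.range (fun a : (sub i).verts => Quiver.Total.mk a.1 (apex i) (leg i a))
  isColimit : ∀ i : Fin steps,
    IsColimitOn diagram (sub i) (diagram.obj (apex i)) (fun a => diagram.map (leg i a))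
  /-- a colimit can be used again only together with the subdiagram that produced it -/
  constructive : ∀ i j : Fin steps, i < j → apex i ∈ (sub j).verts → sub i ≤ sub j

attribute [instance] ColimitComputation.quiver ColimitComputation.finite_verts
  ColimitComputation.finite_edges

namespace ColimitComputation

variable {C : Type u} [Category.{v} C] {A : MorphismProperty C}

/-- The size (cost) of a computation: the number of steps plus the number of basic morphisms, that
is, of edges of the initial diagram. -/
noncomputable def size (P : ColimitComputation A) : ℕ :=
  P.steps + (P.shape 0).edges.ncard

/-- The computation `P` computes the diagram `F`. -/
def Computes (P : ColimitComputation A) {S : Type} [Quiver.{0} S] (F : S ⥤q C) : Prop :=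
  IsIsoToSubdiagram F P.diagram

end ColimitComputation

/-- The vertices of the directed graph `• → •` with two distinct vertices and one edge. -/
inductive ArrowGraph : Type
  | source
  | target

/-- The single edge of `• → •`. -/
inductive ArrowGraph.Edge : ArrowGraph → ArrowGraph → Type
  | edge : ArrowGraph.Edge ArrowGraph.source ArrowGraph.target

instance : Quiver.{0} ArrowGraph where
  Hom := ArrowGraph.Edge

/-- A morphism `f : X ⟶ Y`, regarded as a diagram of shape `• → •`. -/
def morphismDiagram {C : Type u} [Category.{v} C] {X Y : C} (f : X ⟶ Y) : ArrowGraph ⥤q C where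
  obj a := match a with
    | ArrowGraph.source => X
    | ArrowGraph.target => Y
  map e := match e with
    | ArrowGraph.Edge.edge => f

/-- The basic morphisms in the category of modules over `R = k[x₁, …, xₙ]`. -/
inductive PolyModBasic (k : Type w) [Field k] (n : ℕ) :
    MorphismProperty (ModuleCat.{w} (MvPolynomial (Fin n) k))
  /-- multiplication by a variable `R → R` -/
  | var (i : Fin n) : PolyModBasic k n
      (ModuleCat.ofHom (LinearMap.lsmul (MvPolynomial (Fin n) k) (MvPolynomial (Fin n) k)
        (MvPolynomial.X i)))
  /-- multiplication by a constant `R → R` -/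
  | const (c : k) : PolyModBasic k n
      (ModuleCat.ofHom (LinearMap.lsmul (MvPolynomial (Fin n) k) (MvPolynomial (Fin n) k)
        (MvPolynomial.C c)))
  /-- the first inclusion `R → R ⊕ R` -/
  | inl : PolyModBasic k n
      (ModuleCat.ofHom (LinearMap.inl (MvPolynomial (Fin n) k)
        (MvPolynomial (Fin n) k) (MvPolynomial (Fin n) k)))
  /-- the second inclusion `R → R ⊕ R` -/
  | inr : PolyModBasic k n
      (ModuleCat.ofHom (LinearMap.inr (MvPolynomial (Fin n) k)
        (MvPolynomial (Fin n) k) (MvPolynomial (Fin n) k)))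
  /-- the diagonal `R → R ⊕ R` -/
  | diag : PolyModBasic k n
      (ModuleCat.ofHom (LinearMap.prod
        (LinearMap.id : MvPolynomial (Fin n) k →ₗ[MvPolynomial (Fin n) k] MvPolynomial (Fin n) k)
        LinearMap.id))
  /-- the addition `R ⊕ R → R` -/
  | add : PolyModBasic k n
      (ModuleCat.ofHom (LinearMap.coprod
        (LinearMap.id : MvPolynomial (Fin n) k →ₗ[MvPolynomial (Fin n) k] MvPolynomial (Fin n) k)
        LinearMap.id))
  /-- the zero map `R → {0}` -/
  | zero : PolyModBasic k n
      (ModuleCat.ofHom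
        (0 : MvPolynomial (Fin n) k →ₗ[MvPolynomial (Fin n) k] PUnit.{w + 1}))

/-! The first point is that reused colimits can be eliminated. By constructivity an earlier apex is
reused only together with the diagram that produced it, so a cocone on the part of `J_i` inside
`D_0` extends uniquely to all of `J_i`, and every apex is already a colimit of a subdiagram of `D_0`
(`isColimitOn_basicSub`). Hence, for a computation of size s, N has at most 4s generators and 6s
relations, with coefficients that are affine linear forms in at most s of the variables, and im φ is
spanned by at most 4s combinations of the generators with coefficients of the same kind
(`exists_presentation`).

Let B be the matrix with these q combinations as first columns and the l relations of N as last
columns. The relations among the generators of im φ are the first q coordinates of the syzygies of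
B, so what is needed is a bound, uniform in the field, on the cost of generating these syzygies. For
given s there are finitely many formats of B, and all matrices of one format are specializations of
one generic matrix over ℤ[c][X₁, …, X_m]. `exists_isKerTemplate` provides a finite list of vectors
over this ring such that, for every field and every value of c, the members of the list that become
syzygies generate all syzygies. Its proof is Noetherian induction on closed subsets of Spec ℤ[c]: on
an irreducible one, a leading term argument (`exists_ne_zero_forall_ker_le_span`) shows that the
kernel commutes with specialization where some f ≠ 0 does not vanish, and the zero locus of f is
smaller. Passing from m to n variables is a free extension (`mem_span_rename`).

The list consists of fixed polynomials, so its linear forms are evaluated by a fixed number of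
multiplications by variables or constants and of additions. These operations, with equations y = 0 ·
y to impose relations, form a diagram of basic morphisms. The colimit of the part that involves only
generators of the image is im φ, the colimit of the whole is N, and the leg between the two apexes
is the inclusion (`exists_bound_of_presentation`, `GateSystem.exists_computes`). -/

/-! ### Triangular elimination by leading coefficients. -/

section Triangular

variable {A k E E' B : Type*} [CommRing A] [Field k] [AddCommGroup E] [Module A E]
  [AddCommGroup E'] [Module k E'] [LinearOrder B] {φ : A →+* k}

/-- One elimination step. The combination `coef g b • v - coef v b • g` cancels position `b` without
dividing in `A`; the division takes place in the field, after `φ`. Supports are finite, so the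
remainder is bounded by one `e < b`, with `⊥` for empty support. -/
theorem exists_sub_smul_mem_span_of_leading (Φ : E →ₛₗ[φ] E') (coef : E →ₗ[A] (B → A))
    (hfin : ∀ v, {b | coef v b ≠ 0}.Finite) (b : B) (g : E)
    (hg : ∀ c, b < c → coef g c = 0)
    (hgb : ∀ v, (∀ c, b < c → coef v c = 0) → coef v b ≠ 0 → φ (coef g b) ≠ 0) {x : E'}
    (hx : x ∈ Submodule.span k (Φ '' {v | ∀ c, b < c → coef v c = 0})) :
    ∃ a : k, ∃ e : WithBot B, e < b ∧
      x - a • Φ g ∈ Submodule.span k (Φ '' {v | ∀ c : B, e < c → coef v c = 0}) := by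
  have hmono : ∀ e e' : WithBot B, e ≤ e' →
      Submodule.span k (Φ '' {v | ∀ c : B, e < c → coef v c = 0}) ≤
      Submodule.span k (Φ '' {v | ∀ c : B, e' < c → coef v c = 0}) := fun e e' h =>
    Submodule.span_mono (Set.image_mono fun v hv c hc => hv c (h.trans_lt hc))
  have hlow : ∀ v, (∀ c, b ≤ c → coef v c = 0) → ∃ e : WithBot B, e < b ∧
      ∀ c : B, e < c → coef v c = 0 := by
    intro v hv
    refine ⟨(hfin v).toFinset.max, ?_, fun c hc => ?_⟩
    · refine (Finset.sup_lt_iff (WithBot.bot_lt_coe b)).2 fun c hc => ?_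
      rw [Set.Finite.mem_toFinset] at hc
      exact WithBot.coe_lt_coe.2 (not_le.1 fun h => hc (hv c h))
    · by_contra h
      exact absurd (Finset.le_max ((hfin v).mem_toFinset.2 h)) (not_le.2 hc)
  induction hx using Submodule.span_induction with
  | mem x hx =>
    obtain ⟨v, hv, rfl⟩ := hx
    by_cases h0 : coef v b = 0
    · obtain ⟨e, he, hev⟩ := hlow v fun c hc => by
        rcases hc.eq_or_lt with rfl | hc
        · exact h0
        · exact hv c hc
      refine ⟨0, e, he, ?_⟩
      rw [zero_smul, sub_zero]
      exact Submodule.subset_span ⟨v, hev, rfl⟩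
    · have hne := hgb v hv h0
      obtain ⟨e, he, hev⟩ := hlow (coef g b • v - coef v b • g) fun c hc => by
        rcases hc.eq_or_lt with rfl | hc
        · simp [mul_comm]
        · simp [hv c hc, hg c hc]
      refine ⟨(φ (coef g b))⁻¹ * φ (coef v b), e, he, ?_⟩
      have : Φ v - ((φ (coef g b))⁻¹ * φ (coef v b)) • Φ g =
          (φ (coef g b))⁻¹ • Φ (coef g b • v - coef v b • g) := by
        rw [map_sub, map_smulₛₗ, map_smulₛₗ, smul_sub, smul_smul, smul_smul, inv_mul_cancel₀ hne,
          one_smul]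
      rw [this]
      exact Submodule.smul_mem _ _ (Submodule.subset_span ⟨_, hev, rfl⟩)
  | zero => exact ⟨0, ⊥, WithBot.bot_lt_coe b, by simp⟩
  | add x y _ _ hx hy =>
    obtain ⟨a, e, he, h⟩ := hx
    obtain ⟨a', e', he', h'⟩ := hy
    refine ⟨a + a', max e e', max_lt he he', ?_⟩
    have : x + y - (a + a') • Φ g = (x - a • Φ g) + (y - a' • Φ g) := by rw [add_smul]; abel
    rw [this]
    exact Submodule.add_mem _ (hmono _ _ (le_max_left _ _) h) (hmono _ _ (le_max_right _ _) h')
  | smul r x _ hx =>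
    obtain ⟨a, e, he, h⟩ := hx
    refine ⟨r * a, e, he, ?_⟩
    rw [mul_smul, ← smul_sub]
    exact Submodule.smul_mem _ _ h

/-- Well-founded induction on a bound for the positions occurring in the vectors that represent `x`.
At a bound `b` in the upper set `p`, the coefficient of `x` vanishes and so does that of the
remainder, hence the subtracted multiple of `Φ g` is zero and the bound drops. At a bound outside
`p`, the vectors already vanish on `p`. -/
theorem mem_span_image_of_coef_eq_zero [WellFoundedLT B] (Φ : E →ₛₗ[φ] E')
    (coef : E →ₗ[A] (B → A)) (coef' : E' →ₗ[k] (B → k))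
    (hcoef : ∀ v b, coef' (Φ v) b = φ (coef v b))
    (hfin : ∀ v, {b | coef v b ≠ 0}.Finite)
    (hlead : ∀ v b, (∀ c, b < c → coef v c = 0) → coef v b ≠ 0 →
      ∃ g, (∀ c, b < c → coef g c = 0) ∧ φ (coef g b) ≠ 0)
    {p : B → Prop} (hp : ∀ b c, b ≤ c → p b → p c)
    {x : E'} (hx : x ∈ Submodule.span k (Set.range Φ)) (hxp : ∀ b, p b → coef' x b = 0) :
    x ∈ Submodule.span k (Φ '' {v | ∀ b, p b → coef v b = 0}) := by
  have key : ∀ e : WithBot B, ∀ x ∈ Submodule.span k (Φ '' {v | ∀ c : B, e < c → coef v c = 0}),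
      (∀ b, p b → coef' x b = 0) →
      x ∈ Submodule.span k (Φ '' {v | ∀ b, p b → coef v b = 0}) := by
    intro e
    induction e using WellFoundedLT.induction with
    | ind e ih =>
    intro x hx hxp
    induction e with
    | bot =>
      refine Submodule.span_mono (Set.image_mono ?_) hx
      exact fun v hv c _ => hv c (WithBot.bot_lt_coe c)
    | coe b =>
      simp only [WithBot.coe_lt_coe] at hx
      by_cases hb : p b
      swap
      · refine Submodule.span_mono (Set.image_mono ?_) hx
        exact fun v hv c hc => hv c (not_le.1 fun h => hb (hp _ _ h hc))
      -- If no vector leads at `b`, there is nothing to eliminate and `g = 0` serves.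
      obtain ⟨g, hg, hgb, hg0⟩ : ∃ g, (∀ c, b < c → coef g c = 0) ∧
          (∀ v, (∀ c, b < c → coef v c = 0) → coef v b ≠ 0 → φ (coef g b) ≠ 0) ∧
          (g = 0 ∨ φ (coef g b) ≠ 0) := by
        by_cases h : ∃ v, (∀ c, b < c → coef v c = 0) ∧ coef v b ≠ 0
        · obtain ⟨v, hv, hvb⟩ := h
          obtain ⟨g, hg, hgb⟩ := hlead v b hv hvb
          exact ⟨g, hg, fun _ _ _ => hgb, Or.inr hgb⟩
        · exact ⟨0, by simp, fun v hv hvb => (h ⟨v, hv, hvb⟩).elim, Or.inl rfl⟩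
      obtain ⟨a, e, he, h⟩ := exists_sub_smul_mem_span_of_leading Φ coef hfin b g hg hgb hx
      have hzero : ∀ y ∈ Submodule.span k (Φ '' {v | ∀ c : B, e < c → coef v c = 0}),
          coef' y b = 0 := by
        intro y hy
        induction hy using Submodule.span_induction with
        | mem y hy =>
          obtain ⟨v, hv, rfl⟩ := hy
          rw [hcoef, hv b he, map_zero]
        | zero => simp
        | add y z _ _ hy hz => simp [hy, hz]
        | smul r y _ hy => simp [hy]
      have hag : a • Φ g = 0 := by
        rcases hg0 with rfl | hg0
        · simp
        · have h1 := hzero _ h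
          rw [map_sub, map_smul, Pi.sub_apply, hxp b hb, Pi.smul_apply, hcoef, zero_sub,
            neg_eq_zero, smul_eq_mul, mul_eq_zero, or_iff_left hg0] at h1
          rw [h1, zero_smul]
      rw [hag, sub_zero] at h
      exact ih e he x h hxp
  obtain ⟨e, he⟩ : ∃ e : WithBot B,
      x ∈ Submodule.span k (Φ '' {v | ∀ c : B, e < c → coef v c = 0}) := by
    clear hxp
    induction hx using Submodule.span_induction with
    | mem x hx =>
      obtain ⟨v, rfl⟩ := hx
      refine ⟨(hfin v).toFinset.max, Submodule.subset_span ⟨v, fun c hc => ?_, rfl⟩⟩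
      by_contra h
      exact absurd (Finset.le_max ((hfin v).mem_toFinset.2 h)) (not_le.2 hc)
    | zero => exact ⟨⊥, Submodule.zero_mem _⟩
    | add x y _ _ hx hy =>
      obtain ⟨e, he⟩ := hx
      obtain ⟨e', he'⟩ := hy
      refine ⟨max e e', Submodule.add_mem _ (Submodule.span_mono (Set.image_mono ?_) he)
        (Submodule.span_mono (Set.image_mono ?_) he')⟩
      · exact fun v hv c hc => hv c ((le_max_left _ _).trans_lt hc)
      · exact fun v hv c hc => hv c ((le_max_right _ _).trans_lt hc)
    | smul r x _ hx =>
      obtain ⟨e, he⟩ := hx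
      exact ⟨e, Submodule.smul_mem _ _ he⟩
  exact key e x he hxp

end Triangular

/-! ### Leading terms of pairs (v, M v) and generic specialization of kernels. -/

section Graph

open MvPolynomial

variable {A : Type*} [CommRing A] {m p q : ℕ}

/-- The positions of the coefficients of a pair of vectors of polynomials, ordered
lexicographically, with the entries of the second vector dominating. -/
abbrev GraphIndex (m p q : ℕ) : Type := (Fin q ⊕ₗ Fin p) ×ₗ Lex (Fin m →₀ ℕ)

/-- The position of the monomial `a` in the entry `i`. -/
def graphIndex (i : Fin q ⊕ Fin p) (a : Fin m →₀ ℕ) : GraphIndex m p q :=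
  toLex (toLex i, toLex a)

/-- The coefficients of the pair `(v, M v)`. -/
noncomputable def graphCoef (M : Matrix (Fin p) (Fin q) (MvPolynomial (Fin m) A)) :
    (Fin q → MvPolynomial (Fin m) A) →ₗ[A] (GraphIndex m p q → A) where
  toFun v b := coeff (ofLex (ofLex b).2) (Sum.elim v (M.mulVec v) (ofLex (ofLex b).1))
  map_add' v v' := by
    funext b
    rw [Matrix.mulVec_add, Pi.add_apply]
    cases ofLex (ofLex b).1 <;> simp
  map_smul' r v := by
    funext b
    rw [Matrix.mulVec_smul, Pi.smul_apply]
    cases ofLex (ofLex b).1 <;> simp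

theorem graphCoef_graphIndex (M : Matrix (Fin p) (Fin q) (MvPolynomial (Fin m) A))
    (v : Fin q → MvPolynomial (Fin m) A) (i : Fin q ⊕ Fin p) (a : Fin m →₀ ℕ) :
    graphCoef M v (graphIndex i a) = coeff a (Sum.elim v (M.mulVec v) i) := rfl

theorem finite_graphCoef_ne_zero (M : Matrix (Fin p) (Fin q) (MvPolynomial (Fin m) A))
    (v : Fin q → MvPolynomial (Fin m) A) : {b | graphCoef M v b ≠ 0}.Finite := by
  refine ((Set.finite_iUnion fun i : Fin q ⊕ Fin p =>
    (Sum.elim v (M.mulVec v) i).support.finite_toSet.image (graphIndex i))).subset fun b hb => ?_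
  exact Set.mem_iUnion.2 ⟨ofLex (ofLex b).1, ofLex (ofLex b).2, mem_support_iff.2 hb, rfl⟩

theorem graphCoef_monomial_smul (M : Matrix (Fin p) (Fin q) (MvPolynomial (Fin m) A))
    (v : Fin q → MvPolynomial (Fin m) A) (d : Fin m →₀ ℕ) (i : Fin q ⊕ Fin p) (a : Fin m →₀ ℕ) :
    graphCoef M (monomial d (1 : A) • v) (graphIndex i a) =
      if d ≤ a then graphCoef M v (graphIndex i (a - d)) else 0 := by
  have h : Sum.elim (monomial d (1 : A) • v) (M.mulVec (monomial d (1 : A) • v)) i =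
      monomial d (1 : A) * Sum.elim v (M.mulVec v) i := by
    rw [Matrix.mulVec_smul]
    cases i <;> rfl
  rw [graphCoef_graphIndex, h, coeff_monomial_mul', one_mul, graphCoef_graphIndex]

theorem graphIndex_lt_graphIndex {i j : Fin q ⊕ Fin p} {a b : Fin m →₀ ℕ} :
    graphIndex i a < graphIndex j b ↔ toLex i < toLex j ∨ i = j ∧ toLex a < toLex b := by
  rw [graphIndex, graphIndex, Prod.Lex.toLex_lt_toLex]
  rfl

/-- `a` is the leading monomial, in the entry `i`, of some pair `(v, M v)`. -/
def IsLeading (M : Matrix (Fin p) (Fin q) (MvPolynomial (Fin m) A))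
    (v : Fin q → MvPolynomial (Fin m) A) (i : Fin q ⊕ Fin p) (a : Fin m →₀ ℕ) : Prop :=
  (∀ c, graphIndex i a < c → graphCoef M v c = 0) ∧ graphCoef M v (graphIndex i a) ≠ 0

/-- The lexicographic order on exponents is translation invariant and a monomial factor keeps the
entry, so leading exponents are closed under increase, with the same leading coefficient. -/
theorem monomial_smul_leading {M : Matrix (Fin p) (Fin q) (MvPolynomial (Fin m) A)}
    {v : Fin q → MvPolynomial (Fin m) A} {i : Fin q ⊕ Fin p} {a b : Fin m →₀ ℕ} (hab : a ≤ b)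
    (h : IsLeading M v i a) :
    (∀ c, graphIndex i b < c → graphCoef M (monomial (b - a) (1 : A) • v) c = 0) ∧
      graphCoef M (monomial (b - a) (1 : A) • v) (graphIndex i b) =
        graphCoef M v (graphIndex i a) := by
  constructor
  · intro c hc
    obtain ⟨j, d, rfl⟩ : ∃ j d, c = graphIndex j d := ⟨ofLex (ofLex c).1, ofLex (ofLex c).2, rfl⟩
    rw [graphCoef_monomial_smul]
    split_ifs with hd
    · refine h.1 _ ?_
      rw [graphIndex_lt_graphIndex] at hc ⊢
      refine hc.imp id (And.imp id fun hc => ?_)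
      have h1 : toLex a + toLex (b - a) < toLex (d - (b - a)) + toLex (b - a) := by
        rw [← toLex_add, ← toLex_add, add_tsub_cancel_of_le hab, tsub_add_cancel_of_le hd]
        exact hc
      exact lt_of_add_lt_add_right h1
    · rfl
  · rw [graphCoef_monomial_smul, if_pos tsub_le_self, tsub_tsub_cancel_of_le hab]

/-- Dickson's lemma: in each entry the leading exponents have finitely many minimal elements. `f` is
the product of the leading coefficients of one chosen vector for each of them. Every leading
position is reached by a monomial multiple of a chosen vector, whose leading coefficient is a factor
of `f`; the leading coefficient of `v` itself is not controlled. -/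
theorem exists_ne_zero_forall_leading [IsDomain A]
    (M : Matrix (Fin p) (Fin q) (MvPolynomial (Fin m) A)) :
    ∃ f : A, f ≠ 0 ∧ ∀ v b, (∀ c, b < c → graphCoef M v c = 0) → graphCoef M v b ≠ 0 →
      ∃ g, (∀ c, b < c → graphCoef M g c = 0) ∧ graphCoef M g b ∣ f := by
  classical
  have hfin : ∀ i, {a | Minimal (fun a => ∃ v, IsLeading M v i a) a}.Finite := fun i =>
    WellQuasiOrderedLE.finite_of_isAntichain (setOfPred_minimal_antichain _)
  have hg : ∀ i a, ∃ g, (∃ v, IsLeading M v i a) → IsLeading M g i a := by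
    intro i a
    by_cases h : ∃ v, IsLeading M v i a
    · exact ⟨h.choose, fun _ => h.choose_spec⟩
    · exact ⟨0, fun h' => (h h').elim⟩
  choose g hg using hg
  refine ⟨∏ i, ∏ a ∈ (hfin i).toFinset, graphCoef M (g i a) (graphIndex i a), ?_, ?_⟩
  · refine Finset.prod_ne_zero_iff.2 fun i _ => Finset.prod_ne_zero_iff.2 fun a ha => ?_
    rw [Set.Finite.mem_toFinset, Set.mem_ofPred_eq] at ha
    exact (hg i a (ha.1)).2
  · intro v b hv hvb
    obtain ⟨i, b, rfl⟩ : ∃ j d, b = graphIndex j d := ⟨ofLex (ofLex b).1, ofLex (ofLex b).2, rfl⟩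
    obtain ⟨a, hab, ha⟩ := Set.IsPWO.exists_le_minimal
      (s := {a | ∃ v, IsLeading M v i a}) (a := b) (Set.isPWO_of_wellQuasiOrderedLE _)
      ⟨v, hv, hvb⟩
    obtain ⟨h1, h2⟩ := monomial_smul_leading hab (hg i a ha.prop)
    refine ⟨_, h1, ?_⟩
    rw [h2]
    exact (Finset.dvd_prod_of_mem
      (fun a => graphCoef M (g i a) (graphIndex i a)) ((hfin i).mem_toFinset.2 ha)).trans
      (Finset.dvd_prod_of_mem
        (fun i => ∏ a ∈ (hfin i).toFinset, graphCoef M (g i a) (graphIndex i a))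
        (Finset.mem_univ i))

/-- Entrywise specialization of the coefficients of a vector of polynomials. -/
noncomputable def specialize {k : Type*} [CommRing k] (φ : A →+* k) :
    (Fin q → MvPolynomial (Fin m) A) →ₛₗ[φ] (Fin q → MvPolynomial (Fin m) k) where
  toFun v i := map φ (v i)
  map_add' v v' := by funext i; simp
  map_smul' r v := by funext i; simp [smul_eq_C_mul]

theorem mulVec_specialize {k : Type*} [CommRing k] (φ : A →+* k)
    (M : Matrix (Fin p) (Fin q) (MvPolynomial (Fin m) A)) (v : Fin q → MvPolynomial (Fin m) A) :
    (M.map (map φ)).mulVec (specialize φ v) = specialize φ (M.mulVec v) := by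
  funext i
  exact (RingHom.map_mulVec (map φ) M v i).symm

theorem graphCoef_specialize {k : Type*} [CommRing k] (φ : A →+* k)
    (M : Matrix (Fin p) (Fin q) (MvPolynomial (Fin m) A)) (v : Fin q → MvPolynomial (Fin m) A)
    (b : GraphIndex m p q) :
    graphCoef (M.map (map φ)) (specialize φ v) b = φ (graphCoef M v b) := by
  obtain ⟨i, b, rfl⟩ : ∃ j d, b = graphIndex j d := ⟨ofLex (ofLex b).1, ofLex (ofLex b).2, rfl⟩
  rw [graphCoef_graphIndex, graphCoef_graphIndex, mulVec_specialize]
  cases i <;> exact coeff_map φ _ _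

theorem span_range_specialize {k : Type*} [Field k] (φ : A →+* k) :
    Submodule.span k (Set.range (specialize (m := m) (q := q) φ)) = ⊤ := by
  rw [eq_top_iff]
  intro x _
  have h : ∀ (i : Fin q) (P : MvPolynomial (Fin m) k),
      Pi.single i P ∈ Submodule.span k (Set.range (specialize (m := m) (q := q) φ)) := by
    intro i P
    induction P using MvPolynomial.induction_on' with
    | monomial a c =>
      have : (Pi.single i (monomial a c) : Fin q → MvPolynomial (Fin m) k) =
          c • specialize φ (Pi.single i (monomial a (1 : A))) := by
        funext j
        change _ = c • map φ _
        by_cases hj : j = i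
        · subst hj; simp [smul_monomial]
        · simp [hj]
      rw [this]
      exact Submodule.smul_mem _ _ (Submodule.subset_span ⟨_, rfl⟩)
    | add P Q hP hQ =>
      rw [Pi.single_add]
      exact Submodule.add_mem _ hP hQ
  rw [← Finset.univ_sum_single x]
  exact Submodule.sum_mem _ fun i _ => h i _

/-- Since the entries of M v dominate, their positions form an upper set, and a kernel vector is one
whose coefficients vanish there. The triangular argument then expresses each kernel vector over `k`
through specializations of kernel vectors over `A`. -/
theorem exists_ne_zero_forall_ker_le_span [IsDomain A]
    (M : Matrix (Fin p) (Fin q) (MvPolynomial (Fin m) A)) :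
    ∃ f : A, f ≠ 0 ∧ ∀ (k : Type w) [Field k] (φ : A →+* k), φ f ≠ 0 →
      ∀ x : Fin q → MvPolynomial (Fin m) k, (M.map (map φ)).mulVec x = 0 →
        x ∈ Submodule.span k (specialize φ '' {v | M.mulVec v = 0}) := by
  obtain ⟨f, hf, hlead⟩ := exists_ne_zero_forall_leading M
  refine ⟨f, hf, fun k _ φ hφ x hx => ?_⟩
  have h := mem_span_image_of_coef_eq_zero (specialize φ) (graphCoef M)
    (graphCoef (M.map (map φ))) (graphCoef_specialize φ M) (finite_graphCoef_ne_zero M)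
    (fun v b hv hb => by
      obtain ⟨g, hg, hgf⟩ := hlead v b hv hb
      exact ⟨g, hg, fun h0 => hφ (zero_dvd_iff.1 (h0 ▸ map_dvd φ hgf))⟩)
    (p := fun b => ∃ i, (ofLex b).1 = toLex (Sum.inr i))
    (fun b c hbc ⟨i, hi⟩ => by
      have h1 : (ofLex b).1 ≤ (ofLex c).1 := by
        rcases Prod.Lex.le_iff.1 hbc with h | h
        · exact h.le
        · exact h.1.le
      rw [hi] at h1
      obtain ⟨j, hj⟩ : ∃ j, (ofLex c).1 = toLex j := ⟨ofLex (ofLex c).1, rfl⟩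
      rw [hj] at h1 ⊢
      cases j with
      | inl j => exact absurd h1 (Sum.Lex.not_inr_le_inl)
      | inr j => exact ⟨j, rfl⟩)
    (x := x) (by rw [span_range_specialize]; trivial)
    (by
      rintro b ⟨i, hi⟩
      change coeff _ (Sum.elim _ _ (ofLex (ofLex b).1)) = 0
      rw [hi, hx]
      rfl)
  refine Submodule.span_mono (Set.image_mono ?_) h
  intro v hv
  funext i
  ext a
  exact hv (graphIndex (Sum.inr i) a) ⟨i, rfl⟩

end Graph

/-! ### Finite lists of syzygies valid for all specializations. -/

section Templates

open MvPolynomial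

variable {A : Type*} [CommRing A] {m p q : ℕ}

theorem specialize_specialize {A' k : Type*} [CommRing A'] [CommRing k] (π : A →+* A')
    (φ : A' →+* k) (v : Fin q → MvPolynomial (Fin m) A) :
    specialize φ (specialize π v) = specialize (φ.comp π) v := by
  funext i
  exact map_map π φ (v i)

theorem specialize_smul {k : Type*} [CommRing k] (φ : A →+* k) (r : MvPolynomial (Fin m) A)
    (v : Fin q → MvPolynomial (Fin m) A) :
    specialize φ (r • v) = map φ r • specialize φ v := by
  funext i
  exact map_mul (map φ) _ _

theorem specialize_mem_span {k : Type*} [CommRing k] (φ : A →+* k)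
    {s : Set (Fin q → MvPolynomial (Fin m) A)} {v : Fin q → MvPolynomial (Fin m) A}
    (hv : v ∈ Submodule.span (MvPolynomial (Fin m) A) s) :
    specialize φ v ∈ Submodule.span (MvPolynomial (Fin m) k) (specialize φ '' s) := by
  induction hv using Submodule.span_induction with
  | mem v hv => exact Submodule.subset_span ⟨v, hv, rfl⟩
  | zero => simp
  | add v v' _ _ h h' => rw [map_add]; exact Submodule.add_mem _ h h'
  | smul r v _ h => rw [specialize_smul]; exact Submodule.smul_mem _ _ h

theorem specialize_surjective {k : Type*} [CommRing k] {φ : A →+* k}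
    (hφ : Function.Surjective φ) :
    Function.Surjective (specialize (m := m) (q := q) φ) := by
  intro x
  choose v hv using fun i => map_surjective φ hφ (x i)
  exact ⟨v, funext hv⟩

/-- `T` is a finite set of vectors whose specializations along each homomorphism `φ` to a field
that vanishes on `I` contain generators of the kernel of the specialization of `M`. -/
def IsKerTemplate (M : Matrix (Fin p) (Fin q) (MvPolynomial (Fin m) A)) (I : Ideal A)
    (T : Finset (Fin q → MvPolynomial (Fin m) A)) : Prop :=
  ∀ (k : Type w) [Field k] (φ : A →+* k), I ≤ RingHom.ker φ →
    ∀ x : Fin q → MvPolynomial (Fin m) k, (M.map (map φ)).mulVec x = 0 →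
      x ∈ Submodule.span (MvPolynomial (Fin m) k)
        (specialize φ '' {v | v ∈ T ∧ (M.map (map φ)).mulVec (specialize φ v) = 0})

theorem IsKerTemplate.union_left {M : Matrix (Fin p) (Fin q) (MvPolynomial (Fin m) A)}
    {T : Finset (Fin q → MvPolynomial (Fin m) A)} {k : Type w} [Field k] {φ : A →+* k}
    {I : Ideal A} (hT : IsKerTemplate.{w} M I T) (hI : I ≤ RingHom.ker φ)
    {T' : Finset (Fin q → MvPolynomial (Fin m) A)} (h : T ⊆ T')
    {x : Fin q → MvPolynomial (Fin m) k} (hx : (M.map (map φ)).mulVec x = 0) :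
      x ∈ Submodule.span (MvPolynomial (Fin m) k)
        (specialize φ '' {v | v ∈ T' ∧ (M.map (map φ)).mulVec (specialize φ v) = 0}) := by
  refine Submodule.span_mono (Set.image_mono ?_) (hT k φ hI x hx)
  exact fun v hv => ⟨h hv.1, hv.2⟩

/-- Where `f` does not vanish, lifts of generators of the kernel over `A ⧸ I` suffice; the remaining
homomorphisms vanish on the larger ideal `I ⊔ span {f}`. Merging the two lists is harmless, because
only the vectors that become syzygies are used. -/
theorem exists_isKerTemplate_of_isPrime [IsNoetherianRing A]
    (M : Matrix (Fin p) (Fin q) (MvPolynomial (Fin m) A)) (I : Ideal A) (hI : I.IsPrime)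
    (ih : ∀ J > I, ∃ T, IsKerTemplate.{w} M J T) : ∃ T, IsKerTemplate.{w} M I T := by
  classical
  obtain ⟨f', hf', hf⟩ := exists_ne_zero_forall_ker_le_span.{w} (M.map (map (Ideal.Quotient.mk I)))
  obtain ⟨f, rfl⟩ := Ideal.Quotient.mk_surjective f'
  rw [Ne, Ideal.Quotient.eq_zero_iff_mem] at hf'
  obtain ⟨T₁, hT₁⟩ := ih (I ⊔ Ideal.span {f}) (lt_of_le_of_ne le_sup_left fun h => hf' (by
    rw [h]
    exact Ideal.mem_sup_right (Ideal.mem_span_singleton_self f)))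
  obtain ⟨T', hT'⟩ : (LinearMap.ker (M.map (map (Ideal.Quotient.mk I))).mulVecLin).FG :=
    IsNoetherian.noetherian _
  choose lift hlift using specialize_surjective (m := m) (q := q) (φ := Ideal.Quotient.mk I)
    Ideal.Quotient.mk_surjective
  refine ⟨T'.image lift ∪ T₁, fun k _ φ hφ x hx => ?_⟩
  by_cases h0 : φ f = 0
  · refine hT₁.union_left (sup_le hφ ?_) Finset.subset_union_right hx
    rwa [Ideal.span_singleton_le_iff_mem]
  obtain ⟨ψ, rfl⟩ : ∃ ψ : A ⧸ I →+* k, φ = ψ.comp (Ideal.Quotient.mk I) :=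
    ⟨Ideal.Quotient.lift I φ fun a ha => hφ ha, rfl⟩
  have hM : M.map (map (ψ.comp (Ideal.Quotient.mk I))) =
      (M.map (map (Ideal.Quotient.mk I))).map (map ψ) := by
    ext1 i j
    exact (map_map _ _ _).symm
  have h1 := hf k ψ h0 x (by rw [← hM]; exact hx)
  -- The generic statement gives a span over `k` of all kernel vectors over `A ⧸ I`; each of these
  -- is a polynomial combination of the finite set `T'`.
  refine Submodule.span_induction (p := fun x _ => x ∈ Submodule.span (MvPolynomial (Fin m) k) _)
    ?_ (Submodule.zero_mem _) (fun _ _ _ _ => Submodule.add_mem _) ?_ h1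
  · rintro _ ⟨v, hv, rfl⟩
    have hv' : v ∈ LinearMap.ker (M.map (map (Ideal.Quotient.mk I))).mulVecLin := hv
    rw [← hT'] at hv'
    refine Submodule.span_mono ?_ (specialize_mem_span ψ hv')
    rintro _ ⟨t, ht, rfl⟩
    refine ⟨lift t, ⟨Finset.mem_union_left _ (Finset.mem_image_of_mem _ ht), ?_⟩, ?_⟩
    · rw [← specialize_specialize, hlift, hM, mulVec_specialize]
      have h2 : t ∈ LinearMap.ker (M.map (map (Ideal.Quotient.mk I))).mulVecLin := by
        rw [← hT']
        exact Submodule.subset_span ht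
      rw [LinearMap.mem_ker, Matrix.mulVecLin_apply] at h2
      rw [h2, map_zero]
    · rw [← specialize_specialize, hlift]
  · intro c y _ hy
    rw [← algebraMap_smul (MvPolynomial (Fin m) k) c y]
    exact Submodule.smul_mem _ _ hy

/-- Noetherian induction on `I`. If `a * b ∈ I` with neither factor in `I`, a homomorphism to a
field that kills `I` kills `a` or `b`, so the lists for the two larger ideals together cover all
cases. -/
theorem exists_isKerTemplate [IsNoetherianRing A]
    (M : Matrix (Fin p) (Fin q) (MvPolynomial (Fin m) A)) (I : Ideal A) :
    ∃ T, IsKerTemplate.{w} M I T := by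
  classical
  induction I using IsNoetherian.induction with
  | hgt I ih =>
  by_cases hI : Ideal.IsPrime I
  · exact exists_isKerTemplate_of_isPrime M I hI ih
  by_cases htop : I = ⊤
  · refine ⟨∅, fun k _ φ hφ => ?_⟩
    have h1 : (1 : A) ∈ RingHom.ker φ := hφ (by rw [htop]; trivial)
    simp [RingHom.mem_ker] at h1
  · rw [Ideal.isPrime_iff] at hI
    push Not at hI
    obtain ⟨a, b, hab, ha, hb⟩ := hI htop
    have hlt : ∀ c, c ∉ I → I < I ⊔ Ideal.span {c} := fun c hc =>
      lt_of_le_of_ne le_sup_left fun h => hc (by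
        rw [h]
        exact Ideal.mem_sup_right (Ideal.mem_span_singleton_self c))
    obtain ⟨T, hT⟩ := ih _ (hlt a ha)
    obtain ⟨T', hT'⟩ := ih _ (hlt b hb)
    refine ⟨T ∪ T', fun k _ φ hφ x hx => ?_⟩
    have h0 : φ a * φ b = 0 := by rw [← map_mul]; exact hφ hab
    rcases mul_eq_zero.1 h0 with h | h
    · refine hT.union_left (sup_le hφ ?_) Finset.subset_union_left hx
      rwa [Ideal.span_singleton_le_iff_mem]
    · refine hT'.union_left (sup_le hφ ?_) Finset.subset_union_right hx
      rwa [Ideal.span_singleton_le_iff_mem]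

/-- In an `S`-basis of `R`, the matrix acts on each component of `x` separately because its entries
lie in `S`; so every component is a kernel vector over `S`. -/
theorem mem_span_image_of_free {S R : Type*} [CommRing S] [CommRing R] [Algebra S R]
    [Module.Free S R] (M : Matrix (Fin p) (Fin q) S) (x : Fin q → R)
    (hx : (M.map (algebraMap S R)).mulVec x = 0) :
    x ∈ Submodule.span R ((fun y i => algebraMap S R (y i)) '' {y | M.mulVec y = 0}) := by
  classical
  set b := Module.Free.chooseBasis S R
  set s : Finset (Module.Free.ChooseBasisIndex S R) := Finset.univ.biUnion fun j =>
    (b.repr (x j)).support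
  have hsum : x = ∑ β ∈ s, b β • fun j => algebraMap S R (b.repr (x j) β) := by
    funext j
    rw [Finset.sum_apply]
    conv_lhs => rw [← b.linearCombination_repr (x j), Finsupp.linearCombination_apply]
    rw [Finsupp.sum_of_support_subset (s := s)]
    · refine Finset.sum_congr rfl fun β _ => ?_
      rw [Pi.smul_apply, smul_eq_mul, mul_comm, Algebra.smul_def]
    · exact Finset.subset_biUnion_of_mem (fun j => (b.repr (x j)).support) (Finset.mem_univ j)
    · simp
  rw [hsum]
  refine Submodule.sum_mem _ fun β _ => Submodule.smul_mem _ _ (Submodule.subset_span ?_)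
  refine ⟨fun j => b.repr (x j) β, ?_, rfl⟩
  funext i
  have h1 := congrFun hx i
  simp only [Matrix.mulVec, dotProduct, Matrix.map_apply, ← Algebra.smul_def] at h1
  have h2 := congrArg (fun y => b.repr y β) h1
  simpa [Matrix.mulVec, dotProduct] using h2

/-- The larger ring is a polynomial ring over the smaller one in the variables outside the range of
`σ`. -/
theorem free_rename {k τ : Type*} [CommRing k] {σ : Fin m → τ} (hσ : Function.Injective σ) :
    let : Algebra (MvPolynomial (Fin m) k) (MvPolynomial τ k) :=
      (rename σ : MvPolynomial (Fin m) k →ₐ[k] MvPolynomial τ k).toRingHom.toAlgebra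
    Module.Free (MvPolynomial (Fin m) k) (MvPolynomial τ k) := by
  classical
  let : Algebra (MvPolynomial (Fin m) k) (MvPolynomial τ k) :=
    (rename σ : MvPolynomial (Fin m) k →ₐ[k] MvPolynomial τ k).toRingHom.toAlgebra
  let e₁ : (↥(Set.range σ)ᶜ ⊕ Fin m) ≃ τ :=
    (Equiv.sumComm _ _).trans (((Equiv.ofInjective σ hσ).sumCongr (Equiv.refl _)).trans
      (Equiv.Set.sumCompl (Set.range σ)))
  let e : MvPolynomial ↥(Set.range σ)ᶜ (MvPolynomial (Fin m) k) ≃ₐ[k] MvPolynomial τ k :=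
    (sumAlgEquiv k _ _).symm.trans (renameEquiv k e₁)
  have he : ∀ f : MvPolynomial (Fin m) k, e (C f) = rename σ f := by
    intro f
    have h : (e.toAlgHom.toRingHom.comp C) = (rename σ).toRingHom := by
      ext i
      · simp [e]
      · simp [e, e₁]
    exact congrArg (fun g => g f) h
  let e' : MvPolynomial ↥(Set.range σ)ᶜ (MvPolynomial (Fin m) k) ≃ₗ[MvPolynomial (Fin m) k]
      MvPolynomial τ k :=
    { e with
      map_smul' := fun r x => by
        change e (r • x) = rename σ r * e x
        rw [smul_eq_C_mul, map_mul, he] }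
  exact Module.Free.of_equiv e'

theorem mem_span_rename {k τ : Type*} [CommRing k] {σ : Fin m → τ} (hσ : Function.Injective σ)
    (M : Matrix (Fin p) (Fin q) (MvPolynomial (Fin m) k)) (x : Fin q → MvPolynomial τ k)
    (hx : (M.map (rename σ)).mulVec x = 0) :
    x ∈ Submodule.span (MvPolynomial τ k)
      ((fun y i => rename σ (y i)) '' {y | M.mulVec y = 0}) := by
  let : Algebra (MvPolynomial (Fin m) k) (MvPolynomial τ k) :=
    (rename σ : MvPolynomial (Fin m) k →ₐ[k] MvPolynomial τ k).toRingHom.toAlgebra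
  have := free_rename (k := k) hσ
  exact mem_span_image_of_free M x hx

end Templates

/-! ### Systems of gates and the two-step computations attached to them. -/

/-- A system of gates over `R = k[x₁, …, xₙ]`: unknowns `U`, a distinguished set of unknowns `core`,
gates `E` imposing `y (src e) = coef e • y (tgt e)`, where `coef e` is a variable or a constant, and
gates `G` imposing `y (sum g) = y (left g) + y (right g)`. -/
structure GateSystem (k : Type w) [Field k] (n : ℕ) where
  U : Type
  E : Type
  G : Type
  [finite_U : Finite U]
  [finite_E : Finite E]
  [finite_G : Finite G]
  core : Set U
  src : E → U
  tgt : E → U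
  coef : E → MvPolynomial (Fin n) k
  coef_basic : ∀ e, (∃ i, coef e = MvPolynomial.X i) ∨ ∃ c, coef e = MvPolynomial.C c
  sum : G → U
  left : G → U
  right : G → U
  exists_src : ∀ u, ∃ e, src e = u

namespace GateSystem

attribute [instance] finite_U finite_E finite_G

variable {k : Type w} [Field k] {n : ℕ} (S : GateSystem k n)

/-- The assignment `y` satisfies the gates with all unknowns in `K`. -/
def IsSolution (K : Set S.U) {X : Type w} [AddCommGroup X] [Module (MvPolynomial (Fin n) k) X]
    (y : S.U → X) : Prop :=
  (∀ e, S.src e ∈ K → S.tgt e ∈ K → y (S.src e) = S.coef e • y (S.tgt e)) ∧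
    ∀ g, S.sum g ∈ K → S.left g ∈ K → S.right g ∈ K → y (S.sum g) = y (S.left g) + y (S.right g)

/-- The assignment `y` is a universal solution of the gates with all unknowns in `K`. -/
def IsUniversal (K : Set S.U) {W : Type w} [AddCommGroup W] [Module (MvPolynomial (Fin n) k) W]
    (y : S.U → W) : Prop :=
  S.IsSolution K y ∧ ∀ (X : Type w) [AddCommGroup X] [Module (MvPolynomial (Fin n) k) X]
    (x : S.U → X), S.IsSolution K x →
      ∃! t : W →ₗ[MvPolynomial (Fin n) k] X, ∀ u ∈ K, t (y u) = x u

/-- The vertices of the computation: a copy of `R` for each unknown, a copy of `R ⊕ R` for each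
addition gate, the module presented by the core and the module presented by the whole system. -/
inductive Vert : Type
  | scalar (u : S.U)
  | pair (g : S.G)
  | inner
  | total

/-- The edges of the computation. -/
inductive Hom : S.Vert → S.Vert → Type
  | mul (e : S.E) : Hom (.scalar (S.src e)) (.scalar (S.tgt e))
  | inl (g : S.G) : Hom (.scalar (S.left g)) (.pair g)
  | inr (g : S.G) : Hom (.scalar (S.right g)) (.pair g)
  | diag (g : S.G) : Hom (.scalar (S.sum g)) (.pair g)
  | scalarInner (u : S.U) (h : u ∈ S.core) : Hom (.scalar u) .inner
  | pairInner (g : S.G) (h : S.sum g ∈ S.core ∧ S.left g ∈ S.core ∧ S.right g ∈ S.core) :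
      Hom (.pair g) .inner
  | scalarTotal (u : S.U) : Hom (.scalar u) .total
  | pairTotal (g : S.G) : Hom (.pair g) .total
  | innerTotal : Hom .inner .total

instance : Quiver.{0} S.Vert where
  Hom := S.Hom

/-- The step in which a vertex is added. -/
def rank : S.Vert → ℕ
  | .scalar _ => 0
  | .pair _ => 0
  | .inner => 1
  | .total => 2

/-- The vertices of the diagram presenting the core. -/
def IsInner : S.Vert → Prop
  | .scalar u => u ∈ S.core
  | .pair g => S.sum g ∈ S.core ∧ S.left g ∈ S.core ∧ S.right g ∈ S.core
  | .inner => False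
  | .total => False

/-- The leg at a vertex of the diagram presenting the core. -/
def legInner : ∀ v : S.Vert, S.IsInner v → S.Hom v .inner
  | .scalar u, h => .scalarInner u h
  | .pair g, h => .pairInner g h
  | .inner, h => h.elim
  | .total, h => h.elim

/-- The leg at a vertex of the diagram presenting the whole system. -/
def legTotal : ∀ v : S.Vert, S.rank v ≤ 1 → S.Hom v .total
  | .scalar u, _ => .scalarTotal u
  | .pair g, _ => .pairTotal g
  | .inner, _ => .innerTotal
  | .total, h => absurd (show 2 ≤ 1 from h) (by decide)

instance : Finite S.Vert := by
  refine Finite.of_surjective (fun x : S.U ⊕ S.G ⊕ Bool => match x with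
    | .inl u => Vert.scalar u
    | .inr (.inl g) => Vert.pair g
    | .inr (.inr true) => Vert.inner
    | .inr (.inr false) => Vert.total) ?_
  intro v
  cases v with
  | scalar u => exact ⟨.inl u, rfl⟩
  | pair g => exact ⟨.inr (.inl g), rfl⟩
  | inner => exact ⟨.inr (.inr true), rfl⟩
  | total => exact ⟨.inr (.inr false), rfl⟩

/-- The edges of the initial diagram. -/
def basicEdge : S.E ⊕ S.G ⊕ S.G ⊕ S.G → Quiver.Total S.Vert
  | .inl e => ⟨_, _, Hom.mul e⟩
  | .inr (.inl g) => ⟨_, _, Hom.inl g⟩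
  | .inr (.inr (.inl g)) => ⟨_, _, Hom.inr g⟩
  | .inr (.inr (.inr g)) => ⟨_, _, Hom.diag g⟩

instance : Finite (Quiver.Total S.Vert) := by
  refine Finite.of_surjective
    (fun x : (S.E ⊕ S.G ⊕ S.G ⊕ S.G) ⊕ {v // S.IsInner v} ⊕ {v // S.rank v ≤ 1} => match x with
    | .inl x => S.basicEdge x
    | .inr (.inl v) => ⟨_, _, S.legInner v.1 v.2⟩
    | .inr (.inr v) => ⟨_, _, S.legTotal v.1 v.2⟩) ?_
  rintro ⟨a, b, (e : S.Hom a b)⟩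
  cases e with
  | mul e => exact ⟨.inl (.inl e), rfl⟩
  | inl g => exact ⟨.inl (.inr (.inl g)), rfl⟩
  | inr g => exact ⟨.inl (.inr (.inr (.inl g))), rfl⟩
  | diag g => exact ⟨.inl (.inr (.inr (.inr g))), rfl⟩
  | scalarInner u h => exact ⟨.inr (.inl ⟨.scalar u, h⟩), rfl⟩
  | pairInner g h => exact ⟨.inr (.inl ⟨.pair g, h⟩), rfl⟩
  | scalarTotal u => exact ⟨.inr (.inr ⟨.scalar u, zero_le_one⟩), rfl⟩
  | pairTotal g => exact ⟨.inr (.inr ⟨.pair g, zero_le_one⟩), rfl⟩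
  | innerTotal => exact ⟨.inr (.inr ⟨.inner, le_rfl⟩), rfl⟩

end GateSystem

/-- The full subgraph on a set of vertices. -/
def DiSubgraph.induced {V : Type} [Quiver.{0} V] (K : Set V) : DiSubgraph V where
  verts := K
  edges := {e | e.left ∈ K ∧ e.right ∈ K}
  left_mem _ h := h.1
  right_mem _ h := h.2

theorem DiSubgraph.induced_isFullIn {V : Type} [Quiver.{0} V] {K L : Set V} (h : K ⊆ L) :
    (induced K).IsFullIn (induced L) :=
  ⟨⟨h, fun _ he => ⟨h he.1, h he.2⟩⟩, fun _ _ hl hr => ⟨hl, hr⟩⟩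

namespace GateSystem

variable {k : Type w} [Field k] {n : ℕ} (S : GateSystem k n)
  {W₁ W₂ : ModuleCat.{w} (MvPolynomial (Fin n) k)}

/-- The morphism from `R ⊕ R` attached to two elements of a module. -/
noncomputable def pairMap {X : ModuleCat.{w} (MvPolynomial (Fin n) k)} (x y : X) :
    MvPolynomial (Fin n) k × MvPolynomial (Fin n) k →ₗ[MvPolynomial (Fin n) k] X :=
  (LinearMap.toSpanSingleton _ _ x).coprod (LinearMap.toSpanSingleton _ _ y)

/-- The modules at the vertices of the computation. -/
noncomputable def obj (W₁ W₂ : ModuleCat.{w} (MvPolynomial (Fin n) k)) :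
    S.Vert → ModuleCat.{w} (MvPolynomial (Fin n) k)
  | .scalar _ => ModuleCat.of _ (MvPolynomial (Fin n) k)
  | .pair _ => ModuleCat.of _ (MvPolynomial (Fin n) k × MvPolynomial (Fin n) k)
  | .inner => W₁
  | .total => W₂

/-- The legs of the cocone attached to an assignment; there is no leg at the apexes. -/
noncomputable def coconeLeg {X : ModuleCat.{w} (MvPolynomial (Fin n) k)} (y : S.U → X) :
    ∀ v : S.Vert, S.rank v = 0 → (S.obj W₁ W₂ v ⟶ X)
  | .scalar u, _ => ModuleCat.ofHom (LinearMap.toSpanSingleton _ _ (y u))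
  | .pair g, _ => ModuleCat.ofHom (pairMap (y (S.left g)) (y (S.right g)))
  | .inner, h => absurd (show 1 = 0 from h) (by decide)
  | .total, h => absurd (show 2 = 0 from h) (by decide)

/-- The final diagram of the computation. -/
noncomputable def diagram (f : W₁ ⟶ W₂) (y₁ : S.U → W₁) (y₂ : S.U → W₂) :
    S.Vert ⥤q ModuleCat.{w} (MvPolynomial (Fin n) k) where
  obj := S.obj W₁ W₂
  map := fun {_ _} e => match e with
    | .mul e => ModuleCat.ofHom (LinearMap.lsmul _ _ (S.coef e))
    | .inl _ => ModuleCat.ofHom (LinearMap.inl _ _ _)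
    | .inr _ => ModuleCat.ofHom (LinearMap.inr _ _ _)
    | .diag _ => ModuleCat.ofHom (LinearMap.prod LinearMap.id LinearMap.id)
    | .scalarInner u _ => S.coconeLeg (W₁ := W₁) (W₂ := W₂) y₁ (.scalar u) rfl
    | .pairInner g _ => S.coconeLeg (W₁ := W₁) (W₂ := W₂) y₁ (.pair g) rfl
    | .scalarTotal u => S.coconeLeg (W₁ := W₁) (W₂ := W₂) y₂ (.scalar u) rfl
    | .pairTotal g => S.coconeLeg (W₁ := W₁) (W₂ := W₂) y₂ (.pair g) rfl
    | .innerTotal => f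

variable {S} {f : W₁ ⟶ W₂} {y₁ : S.U → W₁} {y₂ : S.U → W₂}

/-- A map out of R is an element. The leg at a copy of R ⊕ R is determined along the two inclusions
by the elements at the summands, and the diagonal edge then says that the third element is their
sum. The sets `K` and `L` are kept general to serve both the core and the whole system. -/
theorem isSolution_of_isCoconeOn {L : Set S.Vert} {K : Set S.U}
    (hs : ∀ u ∈ K, .scalar u ∈ L)
    (hp : ∀ g, S.sum g ∈ K → S.left g ∈ K → S.right g ∈ K → .pair g ∈ L)
    {X : ModuleCat.{w} (MvPolynomial (Fin n) k)}
    {ψ : ∀ a : (DiSubgraph.induced L).verts, (S.diagram f y₁ y₂).obj a.1 ⟶ X}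
    (hψ : IsCoconeOn (S.diagram f y₁ y₂) (DiSubgraph.induced L) X ψ) (x : S.U → X)
    (hx : ∀ (u : S.U) (h : .scalar u ∈ L),
      (ψ ⟨.scalar u, h⟩).hom (1 : MvPolynomial (Fin n) k) = x u) :
    S.IsSolution K x ∧ ∀ (g : S.G) (h : .pair g ∈ L), S.left g ∈ K → S.right g ∈ K →
      (ψ ⟨.pair g, h⟩).hom = pairMap (x (S.left g)) (x (S.right g)) := by
  have hpair : ∀ (g : S.G) (h : .pair g ∈ L), S.left g ∈ K → S.right g ∈ K →
      (ψ ⟨.pair g, h⟩).hom = pairMap (x (S.left g)) (x (S.right g)) := by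
    intro g h hl hr
    have h1 := congrArg (fun t => t.hom (1 : MvPolynomial (Fin n) k))
      (hψ ⟨_, _, Hom.inl g⟩ ⟨hs _ hl, h⟩)
    have h2 := congrArg (fun t => t.hom (1 : MvPolynomial (Fin n) k))
      (hψ ⟨_, _, Hom.inr g⟩ ⟨hs _ hr, h⟩)
    apply LinearMap.prod_ext
    · apply LinearMap.ext_ring
      refine (h1.trans (hx _ _)).trans ?_
      simp [pairMap]
    · apply LinearMap.ext_ring
      refine (h2.trans (hx _ _)).trans ?_
      simp [pairMap]
  refine ⟨⟨fun e hs' ht => ?_, fun g h hl hr => ?_⟩, hpair⟩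
  · have h1 := congrArg (fun t => t.hom (1 : MvPolynomial (Fin n) k))
      (hψ ⟨_, _, Hom.mul e⟩ ⟨hs _ hs', hs _ ht⟩)
    have h2 : (ψ ⟨.scalar (S.tgt e), hs _ ht⟩).hom (S.coef e • (1 : MvPolynomial (Fin n) k)) =
        (ψ ⟨.scalar (S.src e), hs _ hs'⟩).hom (1 : MvPolynomial (Fin n) k) := h1
    rw [← hx _ (hs _ hs'), ← hx _ (hs _ ht), ← h2]
    exact LinearMap.map_smul _ _ _
  · have h1 := congrArg (fun t => t.hom (1 : MvPolynomial (Fin n) k))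
      (hψ ⟨_, _, Hom.diag g⟩ ⟨hs _ h, hp g h hl hr⟩)
    rw [← hx _ (hs _ h)]
    refine h1.symm.trans ?_
    change (ψ ⟨.pair g, hp g h hl hr⟩).hom _ = _
    rw [hpair g (hp g h hl hr) hl hr]
    change pairMap _ _ ((1 : MvPolynomial (Fin n) k), (1 : MvPolynomial (Fin n) k)) = _
    simp [pairMap]

end GateSystem

namespace GateSystem

variable {k : Type w} [Field k] {n : ℕ} {S : GateSystem k n}
  {W₁ W₂ : ModuleCat.{w} (MvPolynomial (Fin n) k)}
  {f : W₁ ⟶ W₂} {y₁ : S.U → W₁} {y₂ : S.U → W₂}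

theorem lsmul_comp_toSpanSingleton {X : ModuleCat.{w} (MvPolynomial (Fin n) k)}
    (r : MvPolynomial (Fin n) k) {x y : X} (h : y = r • x) :
    ModuleCat.ofHom (LinearMap.lsmul (MvPolynomial (Fin n) k) (MvPolynomial (Fin n) k) r) ≫
      ModuleCat.ofHom (LinearMap.toSpanSingleton _ X x) =
    ModuleCat.ofHom (LinearMap.toSpanSingleton _ X y) := by
  apply ModuleCat.hom_ext
  apply LinearMap.ext_ring
  simp [h]

theorem inl_comp_pairMap {X : ModuleCat.{w} (MvPolynomial (Fin n) k)} (x y : X) :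
    ModuleCat.ofHom (LinearMap.inl (MvPolynomial (Fin n) k) (MvPolynomial (Fin n) k)
      (MvPolynomial (Fin n) k)) ≫ ModuleCat.ofHom (pairMap x y) =
    ModuleCat.ofHom (LinearMap.toSpanSingleton _ X x) := by
  apply ModuleCat.hom_ext
  apply LinearMap.ext_ring
  simp [pairMap]

theorem inr_comp_pairMap {X : ModuleCat.{w} (MvPolynomial (Fin n) k)} (x y : X) :
    ModuleCat.ofHom (LinearMap.inr (MvPolynomial (Fin n) k) (MvPolynomial (Fin n) k)
      (MvPolynomial (Fin n) k)) ≫ ModuleCat.ofHom (pairMap x y) =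
    ModuleCat.ofHom (LinearMap.toSpanSingleton _ X y) := by
  apply ModuleCat.hom_ext
  apply LinearMap.ext_ring
  simp [pairMap]

theorem diag_comp_pairMap {X : ModuleCat.{w} (MvPolynomial (Fin n) k)} {x y z : X}
    (h : z = x + y) :
    ModuleCat.ofHom (LinearMap.prod
        (LinearMap.id : MvPolynomial (Fin n) k →ₗ[MvPolynomial (Fin n) k] MvPolynomial (Fin n) k)
        LinearMap.id) ≫ ModuleCat.ofHom (pairMap x y) =
    ModuleCat.ofHom (LinearMap.toSpanSingleton _ X z) := by
  apply ModuleCat.hom_ext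
  apply LinearMap.ext_ring
  simp [pairMap, h]

theorem pairMap_comp {X Y : ModuleCat.{w} (MvPolynomial (Fin n) k)} (t : X ⟶ Y) (x y : X) :
    ModuleCat.ofHom (pairMap x y) ≫ t = ModuleCat.ofHom (pairMap (t.hom x) (t.hom y)) := by
  apply ModuleCat.hom_ext
  apply LinearMap.prod_ext <;> apply LinearMap.ext_ring <;> simp [pairMap]

theorem toSpanSingleton_comp {X Y : ModuleCat.{w} (MvPolynomial (Fin n) k)} (t : X ⟶ Y) (x : X)
    (ψ : ModuleCat.of _ (MvPolynomial (Fin n) k) ⟶ Y) :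
    ModuleCat.ofHom (LinearMap.toSpanSingleton _ X x) ≫ t = ψ ↔
      t.hom x = ψ.hom (1 : MvPolynomial (Fin n) k) := by
  constructor
  · rintro rfl
    simp
  · intro h
    apply ModuleCat.hom_ext
    apply LinearMap.ext_ring
    simpa using h

theorem isColimitOn_inner (hy : S.IsUniversal S.core y₁) :
    IsColimitOn (S.diagram f y₁ y₂) (DiSubgraph.induced {v | S.IsInner v}) W₁
      (fun a => (S.diagram f y₁ y₂).map (V := S.Vert) (S.legInner a.1 a.2)) := by
  classical
  refine ⟨?_, fun X ψ hψ => ?_⟩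
  · rintro ⟨a, b, (e : S.Hom a b)⟩ ⟨ha, hb⟩
    cases e with
    | mul e => exact lsmul_comp_toSpanSingleton _ (hy.1.1 e ha hb)
    | inl g => exact inl_comp_pairMap _ _
    | inr g => exact inr_comp_pairMap _ _
    | diag g => exact diag_comp_pairMap (hy.1.2 g hb.1 hb.2.1 hb.2.2)
    | _ => exact hb.elim
  · let x : S.U → X := fun u =>
      if h : u ∈ S.core then (ψ ⟨.scalar u, h⟩).hom (1 : MvPolynomial (Fin n) k) else 0
    have hx : ∀ (u : S.U) (h : .scalar u ∈ {v | S.IsInner v}),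
        (ψ ⟨.scalar u, h⟩).hom (1 : MvPolynomial (Fin n) k) = x u := by
      intro u h
      have h' : u ∈ S.core := h
      simp only [x, dif_pos h']
    obtain ⟨hsol, hpair⟩ := isSolution_of_isCoconeOn (K := S.core) (fun u h => h)
      (fun g h hl hr => And.intro h ⟨hl, hr⟩) hψ x hx
    obtain ⟨t, ht, huniq⟩ := hy.2 X x hsol
    refine ⟨ModuleCat.ofHom t, ?_, fun t' ht' => ?_⟩
    · rintro ⟨v, hv⟩
      cases v with
      | scalar u => exact (toSpanSingleton_comp _ _ _).2 ((ht u hv).trans (hx u hv).symm)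
      | pair g =>
        refine (pairMap_comp _ _ _).trans ?_
        apply ModuleCat.hom_ext
        refine Eq.trans ?_ (hpair g hv hv.2.1 hv.2.2).symm
        change pairMap (t _) (t _) = _
        rw [ht _ hv.2.1, ht _ hv.2.2]
      | inner => exact hv.elim
      | total => exact hv.elim
    · apply ModuleCat.hom_ext
      exact huniq t'.hom fun u hu => ((toSpanSingleton_comp _ _ _).1 (ht' ⟨.scalar u, hu⟩)).trans
        (hx u hu)

/-- The vertex `inner` imposes no new condition: a map out of `W₁` is determined by its values on
the core elements, and there the leg at `inner` agrees with the composite through `f`. -/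
theorem isColimitOn_total (hy₁ : S.IsUniversal S.core y₁) (hy₂ : S.IsUniversal Set.univ y₂)
    (hf : ∀ u ∈ S.core, f.hom (y₁ u) = y₂ u) :
    IsColimitOn (S.diagram f y₁ y₂) (DiSubgraph.induced {v | S.rank v ≤ 1}) W₂
      (fun a => (S.diagram f y₁ y₂).map (V := S.Vert) (S.legTotal a.1 a.2)) := by
  refine ⟨?_, fun X ψ hψ => ?_⟩
  · rintro ⟨a, b, (e : S.Hom a b)⟩ ⟨ha, hb⟩
    cases e with
    | mul e => exact lsmul_comp_toSpanSingleton _ (hy₂.1.1 e trivial trivial)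
    | inl g => exact inl_comp_pairMap _ _
    | inr g => exact inr_comp_pairMap _ _
    | diag g => exact diag_comp_pairMap (hy₂.1.2 g trivial trivial trivial)
    | scalarInner u hu =>
      exact (toSpanSingleton_comp _ _ _).2 ((hf u hu).trans (one_smul _ (y₂ u)).symm)
    | pairInner g hg =>
      refine (pairMap_comp f _ _).trans ?_
      rw [hf _ hg.2.1, hf _ hg.2.2]
      rfl
    | _ => exact absurd (show 2 ≤ 1 from hb) (by decide)
  · let x : S.U → X := fun u => (ψ ⟨.scalar u, (Nat.zero_le 1)⟩).hom (1 : MvPolynomial (Fin n) k)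
    obtain ⟨hsol, hpair⟩ := isSolution_of_isCoconeOn (K := Set.univ) (fun u _ => (Nat.zero_le 1))
      (fun g _ _ _ => Nat.zero_le 1) hψ x (fun u h => rfl)
    obtain ⟨t, ht, huniq⟩ := hy₂.2 X x hsol
    have hpair' : ∀ g, ModuleCat.ofHom (pairMap (y₂ (S.left g)) (y₂ (S.right g))) ≫
        ModuleCat.ofHom t = ψ ⟨.pair g, (Nat.zero_le 1)⟩ := by
      intro g
      refine (pairMap_comp _ _ _).trans ?_
      apply ModuleCat.hom_ext
      refine Eq.trans ?_ (hpair g (Nat.zero_le 1) trivial trivial).symm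
      change pairMap (t _) (t _) = _
      rw [ht _ trivial, ht _ trivial]
    refine ⟨ModuleCat.ofHom t, ?_, fun t' ht' => ?_⟩
    · rintro ⟨v, hv⟩
      cases v with
      | scalar u => exact (toSpanSingleton_comp _ _ _).2 (ht u trivial)
      | pair g => exact hpair' g
      | inner =>
        obtain ⟨s, -, hs⟩ := hy₁.2 X x ⟨fun e _ _ => hsol.1 e trivial trivial,
          fun g _ _ _ => hsol.2 g trivial trivial trivial⟩
        apply ModuleCat.hom_ext
        refine (hs _ fun u hu => ?_).trans (hs _ fun u hu => ?_).symm
        · change t (f.hom (y₁ u)) = _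
          rw [hf u hu, ht u trivial]
        · have h1 := hψ ⟨_, _, Hom.scalarInner u hu⟩ ⟨Nat.zero_le 1, Nat.le_refl 1⟩
          exact (toSpanSingleton_comp _ _ _).1 h1
      | total => exact absurd (show 2 ≤ 1 from hv) (by decide)
    · apply ModuleCat.hom_ext
      exact huniq t'.hom fun u hu => (toSpanSingleton_comp _ _ _).1 (ht' ⟨.scalar u, (Nat.zero_le 1)⟩)

theorem polyModBasic_basicEdge (x : S.E ⊕ S.G ⊕ S.G ⊕ S.G) :
    PolyModBasic k n ((S.diagram f y₁ y₂).map (S.basicEdge x).hom) := by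
  rcases x with e | g | g | g
  · change PolyModBasic k n (ModuleCat.ofHom (LinearMap.lsmul _ _ (S.coef e)))
    rcases S.coef_basic e with ⟨i, h⟩ | ⟨c, h⟩ <;> rw [h]
    · exact .var i
    · exact .const c
  · exact .inl
  · exact .inr
  · exact .diag

theorem edges_induced_rank_zero :
    (DiSubgraph.induced {v | S.rank v ≤ 0}).edges = Set.range S.basicEdge := by
  apply Set.Subset.antisymm
  · rintro ⟨a, b, (e : S.Hom a b)⟩ ⟨ha, hb⟩
    cases e with
    | mul e => exact ⟨.inl e, rfl⟩
    | inl g => exact ⟨.inr (.inl g), rfl⟩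
    | inr g => exact ⟨.inr (.inr (.inl g)), rfl⟩
    | diag g => exact ⟨.inr (.inr (.inr g)), rfl⟩
    | _ => exact absurd hb (Nat.not_succ_le_zero _)
  · rintro _ ⟨x, rfl⟩
    rcases x with e | g | g | g <;> exact ⟨Nat.zero_le 0, Nat.zero_le 0⟩

/-- The computation attached to a system of gates and universal solutions. -/
noncomputable def computation (hy₁ : S.IsUniversal S.core y₁) (hy₂ : S.IsUniversal Set.univ y₂)
    (hf : ∀ u ∈ S.core, f.hom (y₁ u) = y₂ u) : ColimitComputation (PolyModBasic k n) where
  V := S.Vert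
  diagram := S.diagram f y₁ y₂
  steps := 2
  shape i := DiSubgraph.induced {v | S.rank v ≤ i}
  shape_last_verts := Set.eq_univ_of_forall fun v => by cases v <;> simp [DiSubgraph.induced, rank]
  shape_last_edges := Set.eq_univ_of_forall fun e => by
    have : ∀ v, S.rank v ≤ 2 := fun v => by cases v <;> simp [rank]
    exact ⟨this _, this _⟩
  basic := by
    intro e he
    have he' : e ∈ (DiSubgraph.induced {v | S.rank v ≤ 0}).edges := he
    rw [edges_induced_rank_zero] at he'
    obtain ⟨x, rfl⟩ := he'
    exact polyModBasic_basicEdge x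
  no_isolated := by
    intro a ha
    cases a with
    | scalar u =>
      obtain ⟨e, he⟩ := S.exists_src u
      exact ⟨⟨_, _, Hom.mul e⟩, ⟨Nat.zero_le 0, Nat.zero_le 0⟩, Or.inl (congrArg Vert.scalar he)⟩
    | pair g => exact ⟨⟨_, _, Hom.diag g⟩, ⟨Nat.zero_le 0, Nat.zero_le 0⟩, Or.inr rfl⟩
    | inner => exact absurd (show 1 ≤ 0 from ha) (by decide)
    | total => exact absurd (show 2 ≤ 0 from ha) (by decide)
  sub i := match i with
    | 0 => DiSubgraph.induced {v | S.IsInner v}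
    | 1 => DiSubgraph.induced {v | S.rank v ≤ 1}
  sub_full i := match i with
    | 0 => DiSubgraph.induced_isFullIn fun v hv => by
        cases v with
        | scalar u => exact Nat.zero_le 0
        | pair g => exact Nat.zero_le 0
        | inner => exact False.elim hv
        | total => exact False.elim hv
    | 1 => DiSubgraph.induced_isFullIn fun v hv => hv
  apex i := match i with
    | 0 => .inner
    | 1 => .total
  apex_new i := match i with
    | 0 => fun h => absurd (show 1 ≤ 0 from h) (by decide)
    | 1 => fun h => absurd (show 2 ≤ 1 from h) (by decide)
  leg i := match i with
    | 0 => fun a => S.legInner a.1 a.2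
    | 1 => fun a => S.legTotal a.1 a.2
  verts_succ i := match i with
    | 0 => by
      ext v
      cases v <;> simp [DiSubgraph.induced, rank]
    | 1 => by
      ext v
      cases v <;> simp [DiSubgraph.induced, rank]
  edges_succ i := match i with
    | 0 => by
      apply Set.Subset.antisymm
      · rintro ⟨a, b, (e : S.Hom a b)⟩ ⟨ha, hb⟩
        cases e with
        | scalarInner u h => exact Or.inr ⟨⟨.scalar u, h⟩, rfl⟩
        | pairInner g h => exact Or.inr ⟨⟨.pair g, h⟩, rfl⟩
        | scalarTotal | pairTotal | innerTotal => exact absurd (show 2 ≤ 1 from hb) (by decide)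
        | _ => exact Or.inl ⟨Nat.zero_le 0, Nat.zero_le 0⟩
      · rintro e (he | ⟨⟨v, hv⟩, rfl⟩)
        · exact ⟨he.1.trans (Nat.le_succ _), he.2.trans (Nat.le_succ _)⟩
        · cases v with
          | inner => exact False.elim hv
          | total => exact False.elim hv
          | _ => exact ⟨Nat.zero_le 1, Nat.le_refl 1⟩
    | 1 => by
      apply Set.Subset.antisymm
      · rintro ⟨a, b, (e : S.Hom a b)⟩ ⟨ha, hb⟩
        cases e with
        | scalarTotal u => exact Or.inr ⟨⟨.scalar u, (Nat.zero_le 1)⟩, rfl⟩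
        | pairTotal g => exact Or.inr ⟨⟨.pair g, (Nat.zero_le 1)⟩, rfl⟩
        | innerTotal => exact Or.inr ⟨⟨.inner, Nat.le_refl 1⟩, rfl⟩
        | scalarInner | pairInner => exact Or.inl ⟨Nat.zero_le 1, Nat.le_refl 1⟩
        | _ => exact Or.inl ⟨(Nat.zero_le 1), (Nat.zero_le 1)⟩
      · rintro e (he | ⟨⟨v, hv⟩, rfl⟩)
        · exact ⟨he.1.trans (Nat.le_succ _), he.2.trans (Nat.le_succ _)⟩
        · exact ⟨(show S.rank v ≤ 1 from hv).trans (Nat.le_succ _), Nat.le_refl 2⟩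
  isColimit i := match i with
    | 0 => isColimitOn_inner hy₁
    | 1 => isColimitOn_total hy₁ hy₂ hf
  constructive i j := match i, j with
    | 0, 0 => fun h => absurd h (by decide)
    | 1, 0 => fun h => absurd h (by decide)
    | 1, 1 => fun h => absurd h (by decide)
    | 0, 1 => fun _ _ => by
      have h : {v | S.IsInner v} ⊆ {v | S.rank v ≤ 1} := fun v hv => by
        cases v with
        | scalar u => exact (Nat.zero_le 1)
        | pair g => exact (Nat.zero_le 1)
        | inner => exact False.elim hv
        | total => exact False.elim hv
      exact (DiSubgraph.induced_isFullIn h).1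

/-- Two colimit steps, one edge for each scalar gate, and three for each addition gate: two
inclusions and the diagonal. The inclusion of the core diagram in the total one is what
constructivity requires. -/
theorem exists_computes (hy₁ : S.IsUniversal S.core y₁) (hy₂ : S.IsUniversal Set.univ y₂)
    (hf : ∀ u ∈ S.core, f.hom (y₁ u) = y₂ u) :
    ∃ Q : ColimitComputation (PolyModBasic k n), Q.Computes (morphismDiagram f) ∧
      Q.size ≤ 2 + (Nat.card S.E + 3 * Nat.card S.G) := by
  refine ⟨computation hy₁ hy₂ hf, ?_, ?_⟩
  · let g : ArrowGraph ⥤q S.Vert :=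
      { obj := fun a => match a with
          | .source => .inner
          | .target => .total
        map := fun {_ _} e => match e with
          | .edge => Hom.innerTotal }
    refine ⟨g, ?_, ?_, fun a => match a with
      | .source => Iso.refl _
      | .target => Iso.refl _, ?_⟩
    · rintro (_ | _) (_ | _) h
      · rfl
      · exact absurd h (by simp [g])
      · exact absurd h (by simp [g])
      · rfl
    · rintro _ _ ⟨⟩ ⟨⟩ _
      rfl
    · rintro _ _ ⟨⟩
      exact (Category.comp_id _).trans (Category.id_comp _).symm
  · refine Nat.add_le_add_left ?_ 2
    change (DiSubgraph.induced {v | S.rank v ≤ 0}).edges.ncard ≤ _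
    rw [edges_induced_rank_zero]
    refine (Finite.card_range_le S.basicEdge).trans ?_
    rw [Nat.card_sum, Nat.card_sum, Nat.card_sum]
    omega

end GateSystem

/-! ### Linear terms and their translation into gates. -/

/-- Linear terms in generators `γ` with scalars `κ`. -/
inductive LinearTerm (γ κ : Type) : Type
  | gen (g : γ)
  | zero
  | smul (i : κ) (t : LinearTerm γ κ)
  | add (s t : LinearTerm γ κ)

namespace LinearTerm

variable {γ γ' κ : Type}

/-- The value of a term. -/
def eval {R X : Type*} [CommRing R] [AddCommGroup X] [Module R X] (ρ : κ → R) (x : γ → X) :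
    LinearTerm γ κ → X
  | gen g => x g
  | zero => 0
  | smul i t => ρ i • eval ρ x t
  | add s t => eval ρ x s + eval ρ x t

/-- All generators of the term lie in `K`. -/
def UsesOnly (K : Set γ) : LinearTerm γ κ → Prop
  | gen g => g ∈ K
  | zero => True
  | smul _ t => UsesOnly K t
  | add s t => UsesOnly K s ∧ UsesOnly K t

/-- Renaming of generators. -/
def map (f : γ → γ') : LinearTerm γ κ → LinearTerm γ' κ
  | gen g => gen (f g)
  | zero => zero
  | smul i t => smul i (map f t)
  | add s t => add (map f s) (map f t)

/-- The subterms of a term. -/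
def subterms : LinearTerm γ κ → Set (LinearTerm γ κ)
  | gen g => {gen g}
  | zero => {zero}
  | smul i t => insert (smul i t) (subterms t)
  | add s t => insert (add s t) (subterms s ∪ subterms t)

/-- The set contains the subterms of its elements. -/
def IsSubtermClosed (s : Set (LinearTerm γ κ)) : Prop :=
  (∀ i t, smul i t ∈ s → t ∈ s) ∧ ∀ a b, add a b ∈ s → a ∈ s ∧ b ∈ s

theorem finite_subterms (t : LinearTerm γ κ) : t.subterms.Finite := by
  induction t with
  | gen g => exact Set.finite_singleton _
  | zero => exact Set.finite_singleton _
  | smul i t ih => exact ih.insert _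
  | add s t hs ht => exact (hs.union ht).insert _

theorem self_mem_subterms (t : LinearTerm γ κ) : t ∈ t.subterms := by
  cases t <;> simp [subterms]

theorem isSubtermClosed_subterms (t : LinearTerm γ κ) : IsSubtermClosed t.subterms := by
  induction t with
  | gen g => constructor <;> simp [subterms]
  | zero => constructor <;> simp [subterms]
  | smul i t ih =>
    refine ⟨fun j s h => ?_, fun a b h => ?_⟩
    · rcases h with h | h
      · cases h
        exact Or.inr (self_mem_subterms t)
      · exact Or.inr (ih.1 j s h)
    · rcases h with h | h
      · cases h
      · exact (ih.2 a b h).imp Or.inr Or.inr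
  | add s t hs ht =>
    refine ⟨fun j r h => ?_, fun a b h => ?_⟩
    · rcases h with h | h | h
      · cases h
      · exact Or.inr (Or.inl (hs.1 j r h))
      · exact Or.inr (Or.inr (ht.1 j r h))
    · rcases h with h | h | h
      · cases h
        exact ⟨Or.inr (Or.inl (self_mem_subterms s)), Or.inr (Or.inr (self_mem_subterms t))⟩
      · exact (hs.2 a b h).imp (fun h => Or.inr (Or.inl h)) (fun h => Or.inr (Or.inl h))
      · exact (ht.2 a b h).imp (fun h => Or.inr (Or.inr h)) (fun h => Or.inr (Or.inr h))

theorem exists_finite_isSubtermClosed {s : Set (LinearTerm γ κ)} (hs : s.Finite) :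
    ∃ s' : Set (LinearTerm γ κ), s ⊆ s' ∧ s'.Finite ∧ IsSubtermClosed s' := by
  refine ⟨⋃ t ∈ s, subterms t, fun t ht => Set.mem_biUnion ht (self_mem_subterms t),
    hs.biUnion fun t _ => finite_subterms t, fun i t h => ?_, fun a b h => ?_⟩
  · obtain ⟨r, hr, h⟩ := Set.mem_iUnion₂.1 h
    exact Set.mem_biUnion hr ((isSubtermClosed_subterms r).1 i t h)
  · obtain ⟨r, hr, h⟩ := Set.mem_iUnion₂.1 h
    exact ((isSubtermClosed_subterms r).2 a b h).imp (Set.mem_biUnion hr) (Set.mem_biUnion hr)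

section Eval

variable {R X Y : Type*} [CommRing R] [AddCommGroup X] [Module R X] [AddCommGroup Y] [Module R Y]

theorem eval_map (ρ : κ → R) (f : γ → γ') (x : γ' → X) (t : LinearTerm γ κ) :
    (t.map f).eval ρ x = t.eval ρ (x ∘ f) := by
  induction t with
  | gen g => rfl
  | zero => rfl
  | smul i t ih => simp only [map, eval, ih]
  | add s t hs ht => simp only [map, eval, hs, ht]

theorem usesOnly_map (f : γ → γ') (t : LinearTerm γ κ) : (t.map f).UsesOnly (Set.range f) := by
  induction t with
  | gen g => exact ⟨g, rfl⟩
  | zero => trivial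
  | smul i t ih => exact ih
  | add s t hs ht => exact ⟨hs, ht⟩

theorem usesOnly_univ (t : LinearTerm γ κ) : t.UsesOnly Set.univ := by
  induction t with
  | gen g => trivial
  | zero => trivial
  | smul i t ih => exact ih
  | add s t hs ht => exact ⟨hs, ht⟩

theorem map_eval (ρ : κ → R) (f : X →ₗ[R] Y) {K : Set γ} {x : γ → X} {y : γ → Y}
    (h : ∀ g ∈ K, f (x g) = y g) {t : LinearTerm γ κ} (ht : t.UsesOnly K) :
    f (t.eval ρ x) = t.eval ρ y := by
  induction t with
  | gen g => exact h g ht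
  | zero => exact map_zero f
  | smul i t ih => simp only [eval, map_smul, ih ht]
  | add s t hs ht' => simp only [eval, map_add, hs ht.1, ht' ht.2]

end Eval

/-- The value of a polynomial whose variables are interpreted by scalars. -/
noncomputable def scalarEval {R C D : Type*} [CommRing R] (ρ : Option (C ⊕ D) → R) :
    MvPolynomial D (MvPolynomial C ℤ) →+* R :=
  MvPolynomial.eval₂Hom (MvPolynomial.eval₂Hom (Int.castRingHom R) fun c => ρ (some (Sum.inl c)))
    fun d => ρ (some (Sum.inr d))

/-- The term `t` represents the linear form with coefficients `v`. -/
def Represents {C D : Type} [Fintype γ] (t : LinearTerm γ (Option (C ⊕ D)))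
    (v : γ → MvPolynomial D (MvPolynomial C ℤ)) : Prop :=
  ∀ (R X : Type w) [CommRing R] [AddCommGroup X] [Module R X] (ρ : Option (C ⊕ D) → R) (x : γ → X),
    ρ none = -1 → t.eval ρ x = ∑ g, scalarEval ρ (v g) • x g

section Represents

variable {C D : Type} [Fintype γ]

theorem Represents.add {s t : LinearTerm γ (Option (C ⊕ D))}
    {v v' : γ → MvPolynomial D (MvPolynomial C ℤ)} (hs : Represents.{w} s v)
    (ht : Represents.{w} t v') : Represents.{w} (.add s t) (v + v') := by
  intro R X _ _ _ ρ x hρ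
  simp only [eval, hs R X ρ x hρ, ht R X ρ x hρ, Pi.add_apply, map_add, add_smul,
    Finset.sum_add_distrib]

theorem Represents.smul {t : LinearTerm γ (Option (C ⊕ D))}
    {v : γ → MvPolynomial D (MvPolynomial C ℤ)} (ht : Represents.{w} t v)
    (i : Option (C ⊕ D)) (P : MvPolynomial D (MvPolynomial C ℤ))
    (hP : ∀ (R : Type w) [CommRing R] (ρ : Option (C ⊕ D) → R), ρ none = -1 →
      scalarEval ρ P = ρ i) : Represents.{w} (.smul i t) (P • v) := by
  intro R X _ _ _ ρ x hρ
  simp only [eval, ht R X ρ x hρ, Pi.smul_apply, smul_eq_mul, map_mul, hP R ρ hρ, Finset.smul_sum,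
    smul_smul]

theorem represents_zero : Represents.{w} (.zero : LinearTerm γ (Option (C ⊕ D))) 0 := by
  intro R X _ _ _ ρ x hρ
  simp [eval]

/-- The term follows the construction of `P` from integers, coefficient symbols and variables, so it
depends on no ring or module. Negative integers are reached through the scalar `none`, interpreted
as -1. -/
theorem exists_represents_smul (P : MvPolynomial D (MvPolynomial C ℤ)) :
    ∀ v : γ → MvPolynomial D (MvPolynomial C ℤ),
      (∃ t : LinearTerm γ (Option (C ⊕ D)), Represents.{w} t v) →
      ∃ t : LinearTerm γ (Option (C ⊕ D)), Represents.{w} t (P • v) := by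
  induction P using MvPolynomial.induction_on with
  | C a =>
    induction a using MvPolynomial.induction_on with
    | C z =>
      induction z using Int.induction_on with
      | zero => exact fun v _ => ⟨.zero, by simpa using represents_zero⟩
      | succ i ih =>
        intro v hv
        obtain ⟨t, ht⟩ := ih v hv
        obtain ⟨s, hs⟩ := hv
        refine ⟨.add t s, ?_⟩
        rw [map_add, map_add, map_one, map_one, add_smul, one_smul]
        exact ht.add hs
      | pred i ih =>
        intro v hv
        obtain ⟨t, ht⟩ := ih v hv
        obtain ⟨s, hs⟩ := hv
        refine ⟨.add t (.smul none s), ?_⟩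
        rw [sub_eq_add_neg, map_add, map_add, add_smul]
        refine ht.add (hs.smul none _ fun R _ ρ hρ => ?_)
        simp [scalarEval, hρ]
    | add a b ha hb =>
      intro v hv
      obtain ⟨s, hs⟩ := ha v hv
      obtain ⟨t, ht⟩ := hb v hv
      refine ⟨.add s t, ?_⟩
      rw [map_add, add_smul]
      exact hs.add ht
    | mul_X a c ha =>
      intro v hv
      obtain ⟨s, hs⟩ := ha v hv
      refine ⟨.smul (some (Sum.inl c)) s, ?_⟩
      rw [map_mul, mul_comm, mul_smul]
      refine hs.smul _ _ fun R _ ρ hρ => ?_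
      simp [scalarEval]
  | add a b ha hb =>
    intro v hv
    obtain ⟨s, hs⟩ := ha v hv
    obtain ⟨t, ht⟩ := hb v hv
    refine ⟨.add s t, ?_⟩
    rw [add_smul]
    exact hs.add ht
  | mul_X a d ha =>
    intro v hv
    obtain ⟨s, hs⟩ := ha v hv
    refine ⟨.smul (some (Sum.inr d)) s, ?_⟩
    rw [mul_comm, mul_smul]
    refine hs.smul _ _ fun R _ ρ hρ => ?_
    simp [scalarEval]

theorem exists_represents (v : γ → MvPolynomial D (MvPolynomial C ℤ)) :
    ∃ t : LinearTerm γ (Option (C ⊕ D)), Represents.{w} t v := by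
  classical
  have h : ∀ s : Finset γ, ∃ t : LinearTerm γ (Option (C ⊕ D)),
      Represents.{w} t (∑ g ∈ s, Pi.single g (v g)) := by
    intro s
    induction s using Finset.induction_on with
    | empty => exact ⟨.zero, by simpa using represents_zero⟩
    | insert g s hg ih =>
      obtain ⟨t, ht⟩ := ih
      have h1 : Represents.{w} (.gen g : LinearTerm γ (Option (C ⊕ D))) (Pi.single g 1) := by
        intro R X _ _ _ ρ x hρ
        rw [Finset.sum_eq_single g]
        · simp [eval]
        · intro g' _ hg'
          simp [hg']
        · simp
      obtain ⟨r, hr⟩ := exists_represents_smul (v g) _ ⟨_, h1⟩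
      refine ⟨.add r t, ?_⟩
      rw [Finset.sum_insert hg]
      refine Represents.add ?_ ht
      convert hr using 1
      rw [← Pi.single_smul, smul_eq_mul, mul_one]
  obtain ⟨t, ht⟩ := h Finset.univ
  exact ⟨t, by rwa [Finset.univ_sum_single] at ht⟩

end Represents

section System

variable {k : Type w} [Field k] {n : ℕ}

/-- The system of gates that computes the terms in `s` and imposes the vanishing of the terms
in `Z`. -/
noncomputable def system (s : Set (LinearTerm γ κ)) (hs : s.Finite)
    (Z : Set (LinearTerm γ κ)) (K : Set γ) (ρ : κ → MvPolynomial (Fin n) k)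
    (hρ : ∀ i, (∃ j, ρ i = MvPolynomial.X j) ∨ ∃ c, ρ i = MvPolynomial.C c) :
    GateSystem k n :=
  have : Finite s := hs
  { U := s
    E := {p : κ × s // smul p.1 p.2.1 ∈ s} ⊕ {z : s // z.1 ∈ Z ∨ z.1 = zero} ⊕ s
    G := {p : s × s // add p.1.1 p.2.1 ∈ s}
    finite_E := by
      have : Finite {p : κ × s // smul p.1 p.2.1 ∈ s} :=
        Finite.of_injective (fun p => (⟨_, p.2⟩ : s)) (by
          rintro ⟨⟨i, t⟩, h⟩ ⟨⟨i', t'⟩, h'⟩ hh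
          simpa [Subtype.ext_iff] using hh)
      infer_instance
    core := {u | u.1.UsesOnly K}
    src := Sum.elim (fun p => ⟨_, p.2⟩) (Sum.elim (fun z => z.1) id)
    tgt := Sum.elim (fun p => p.1.2) (Sum.elim (fun z => z.1) id)
    coef := Sum.elim (fun p => ρ p.1.1)
      (Sum.elim (fun _ => MvPolynomial.C 0) fun _ => MvPolynomial.C 1)
    coef_basic := by
      rintro (p | z | u)
      · exact hρ _
      · exact Or.inr ⟨_, rfl⟩
      · exact Or.inr ⟨_, rfl⟩
    sum := fun p => ⟨_, p.2⟩
    left := fun p => p.1.1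
    right := fun p => p.1.2
    exists_src := fun u => ⟨Sum.inr (Sum.inr u), rfl⟩ }

variable {s : Set (LinearTerm γ κ)} {hs : s.Finite}
    {Z : Set (LinearTerm γ κ)} {K : Set γ} {ρ : κ → MvPolynomial (Fin n) k}
    {hρ : ∀ i, (∃ j, ρ i = MvPolynomial.X j) ∨ ∃ c, ρ i = MvPolynomial.C c}

/-- The three kinds of scalar gates each inject into `s`. In particular a multiplication gate is
determined by the term it computes, however many scalars there are. -/
theorem card_system_E_le : Nat.card (system s hs Z K ρ hρ).E ≤ 3 * s.ncard := by
  have : Finite s := hs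
  have hinj : Function.Injective
      (fun p : {p : κ × s // smul p.1 p.2.1 ∈ s} => (⟨_, p.2⟩ : s)) := by
    rintro ⟨⟨i, t⟩, h⟩ ⟨⟨i', t'⟩, h'⟩ hh
    simpa [Subtype.ext_iff] using hh
  have := Finite.of_injective _ hinj
  have h1 := Nat.card_le_card_of_injective _ hinj
  have h2 := Nat.card_le_card_of_injective
    (fun z : {z : s // z.1 ∈ Z ∨ z.1 = zero} => z.1) Subtype.val_injective
  change Nat.card ({p : κ × s // smul p.1 p.2.1 ∈ s} ⊕ {z : s // z.1 ∈ Z ∨ z.1 = zero} ⊕ s) ≤ _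
  rw [Nat.card_sum, Nat.card_sum]
  rw [Nat.card_coe_set_eq] at *
  omega

theorem card_system_G_le : Nat.card (system s hs Z K ρ hρ).G ≤ s.ncard := by
  have : Finite s := hs
  refine Nat.card_le_card_of_injective
    (fun p : {p : s × s // add p.1.1 p.2.1 ∈ s} => (⟨_, p.2⟩ : s)) ?_
  rintro ⟨⟨a, b⟩, h⟩ ⟨⟨a', b'⟩, h'⟩ hh
  have h1 : (a : LinearTerm γ κ) = a' ∧ (b : LinearTerm γ κ) = b' := by
    simpa [Subtype.ext_iff] using hh
  exact Subtype.ext (Prod.ext (Subtype.ext h1.1) (Subtype.ext h1.2))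

/-- By induction on terms, the gates force each unknown to be the value of its term at the
generators, so a solution amounts to an assignment of generators that kills `Z`. Loops with
coefficient 0 impose vanishing, including that of the term `zero`; loops with coefficient 1 impose
nothing and only prevent isolated vertices. -/
theorem system_isUniversal (hc : IsSubtermClosed s) (hgen : ∀ g, gen g ∈ s) (hZ : Z ⊆ s) (K' : Set γ) {W : Type w}
    [AddCommGroup W] [Module (MvPolynomial (Fin n) k) W] (xW : γ → W)
    (hW : ∀ z ∈ Z, z.UsesOnly K' → z.eval ρ xW = 0)
    (huniv : ∀ (X : Type w) [AddCommGroup X] [Module (MvPolynomial (Fin n) k) X] (x : γ → X),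
      (∀ z ∈ Z, z.UsesOnly K' → z.eval ρ x = 0) →
      ∃! t : W →ₗ[MvPolynomial (Fin n) k] X, ∀ g ∈ K', t (xW g) = x g) :
    (system s hs Z K ρ hρ).IsUniversal {u : s | u.1.UsesOnly K'}
      (fun u : s => u.1.eval ρ xW) := by
  refine ⟨⟨?_, ?_⟩, fun X _ _ y hy => ?_⟩
  · rintro (⟨p, hp⟩ | ⟨z, hz⟩ | u) h h'
    · rfl
    · change z.1.eval ρ xW = MvPolynomial.C 0 • z.1.eval ρ xW
      rw [map_zero, zero_smul]
      rcases hz with hz | hz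
      · exact hW _ hz h
      · rw [hz]
        rfl
    · change u.1.eval ρ xW = MvPolynomial.C 1 • u.1.eval ρ xW
      rw [map_one, one_smul]
  · rintro ⟨p, hp⟩ h h' h''
    rfl
  · let x : γ → X := fun g => y (⟨gen g, hgen g⟩ : s)
    have hyx : ∀ (t : LinearTerm γ κ) (ht : t ∈ s), t.UsesOnly K' →
        y (⟨t, ht⟩ : s) = t.eval ρ x := by
      intro t
      induction t with
      | gen g => exact fun _ _ => rfl
      | zero =>
        intro ht hK
        have h := hy.1 (Sum.inr (Sum.inl ⟨⟨zero, ht⟩, Or.inr rfl⟩)) hK hK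
        refine h.trans ?_
        change (MvPolynomial.C 0 : MvPolynomial (Fin n) k) • y _ = 0
        rw [map_zero, zero_smul]
      | smul i t ih =>
        intro ht hK
        have h := hy.1 (Sum.inl ⟨(i, ⟨t, hc.1 i t ht⟩), ht⟩) hK hK
        refine h.trans ?_
        rw [eval, ← ih (hc.1 i t ht) hK]
        rfl
      | add a b iha ihb =>
        intro ht hK
        have hab := hc.2 a b ht
        have h := hy.2 ⟨(⟨a, hab.1⟩, ⟨b, hab.2⟩), ht⟩ hK hK.1 hK.2
        refine h.trans ?_
        rw [eval, ← iha hab.1 hK.1, ← ihb hab.2 hK.2]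
        rfl
    obtain ⟨t, ht, huniq⟩ := huniv X x fun z hz hK => by
      rw [← hyx z (hZ hz) hK]
      have h := hy.1 (Sum.inr (Sum.inl ⟨⟨z, hZ hz⟩, Or.inl hz⟩)) hK hK
      refine h.trans ?_
      change (MvPolynomial.C 0 : MvPolynomial (Fin n) k) • y _ = 0
      rw [map_zero, zero_smul]
    refine ⟨t, ?_, fun t' ht' => huniq t' fun g hg => ht' (⟨gen g, hgen g⟩ : s) hg⟩
    rintro ⟨u, hu⟩ hK
    exact (map_eval ρ t ht hK).trans (hyx u hu hK).symm

end System

end LinearTerm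

/-! ### The bound for a fixed format of presentation. -/

section Bound

open MvPolynomial LinearTerm

/-- The generic matrix of affine linear forms in `m` variables. -/
noncomputable def affineMatrix (m p q : ℕ) : Matrix (Fin p) (Fin q)
    (MvPolynomial (Fin m) (MvPolynomial (Fin p × Fin q × Option (Fin m)) ℤ)) :=
  Matrix.of fun i j => C (X (i, j, none)) + ∑ l, C (X (i, j, some l)) * X l

/-- The interpretation of the coefficients as constants and of the variables as variables. -/
noncomputable def scalars {k : Type*} [Field k] {m n : ℕ} {Γ : Type*} (c : Γ → k)
    (σ : Fin m → Fin n) : Option (Γ ⊕ Fin m) → MvPolynomial (Fin n) k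
  | none => -1
  | some (Sum.inl a) => C (c a)
  | some (Sum.inr l) => X (σ l)

theorem scalars_basic {k : Type*} [Field k] {m n : ℕ} {Γ : Type*} (c : Γ → k)
    (σ : Fin m → Fin n) (i : Option (Γ ⊕ Fin m)) :
    (∃ j, scalars c σ i = X j) ∨ ∃ a, scalars c σ i = C a := by
  match i with
  | none => exact Or.inr ⟨-1, by simp [scalars]⟩
  | some (Sum.inl a) => exact Or.inr ⟨_, rfl⟩
  | some (Sum.inr l) => exact Or.inl ⟨_, rfl⟩

theorem scalarEval_scalars {k : Type*} [Field k] {m n : ℕ} {Γ : Type*} (c : Γ → k)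
    (σ : Fin m → Fin n) (P : MvPolynomial (Fin m) (MvPolynomial Γ ℤ)) :
    scalarEval (scalars c σ) P = rename σ (map (eval₂Hom (Int.castRingHom k) c) P) := by
  have h : scalarEval (scalars c σ) =
      (rename σ).toRingHom.comp (map (eval₂Hom (Int.castRingHom k) c)) := by
    apply MvPolynomial.ringHom_ext'
    · apply MvPolynomial.ringHom_ext'
      · exact RingHom.ext_int _ _
      · intro a
        simp [scalarEval, scalars]
    · intro l
      simp [scalarEval, scalars]
  exact congrArg (fun f => f P) h

theorem scalarEval_affineMatrix {k : Type*} [Field k] {m n p q : ℕ}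
    (c : Fin p × Fin q × Option (Fin m) → k) (σ : Fin m → Fin n) (i : Fin p) (j : Fin q) :
    scalarEval (scalars c σ) (affineMatrix m p q i j) =
      C (c (i, j, none)) + ∑ l, C (c (i, j, some l)) * X (σ l) := by
  simp [scalarEval, affineMatrix, scalars]

theorem specialize_apply {A k : Type*} [CommRing A] [CommRing k] {m q : ℕ} (φ : A →+* k)
    (v : Fin q → MvPolynomial (Fin m) A) (j : Fin q) : specialize φ v j = map φ (v j) := rfl

theorem exists_template_affineMatrix (m p q : ℕ) :
    ∃ T : Finset (Fin q →
        MvPolynomial (Fin m) (MvPolynomial (Fin p × Fin q × Option (Fin m)) ℤ)),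
      ∀ (k : Type w) [Field k] (n : ℕ) (c : Fin p × Fin q × Option (Fin m) → k)
        (σ : Fin m → Fin n), Function.Injective σ → ∀ x : Fin q → MvPolynomial (Fin n) k,
        ((affineMatrix m p q).map (scalarEval (scalars c σ))).mulVec x = 0 →
        x ∈ Submodule.span (MvPolynomial (Fin n) k)
          ((fun v j => scalarEval (scalars c σ) (v j)) '' {v | v ∈ T ∧
            ((affineMatrix m p q).map (scalarEval (scalars c σ))).mulVec
              (fun j => scalarEval (scalars c σ) (v j)) = 0}) := by
  obtain ⟨T, hT⟩ := exists_isKerTemplate.{w} (affineMatrix m p q) ⊥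
  refine ⟨T, fun k _ n c σ hσ x hx => ?_⟩
  have hM : (affineMatrix m p q).map (scalarEval (scalars c σ)) =
      ((affineMatrix m p q).map (map (eval₂Hom (Int.castRingHom k) c))).map (rename σ) := by
    ext1 i j
    exact scalarEval_scalars c σ _
  rw [hM] at hx
  refine Submodule.span_le.2 ?_ (mem_span_rename hσ _ x hx)
  rintro _ ⟨y, hy, rfl⟩
  have hy' := hT k (eval₂Hom (Int.castRingHom k) c) bot_le y hy
  clear hx hy
  induction hy' using Submodule.span_induction with
  | mem y hy =>
    obtain ⟨v, ⟨hv, hv0⟩, rfl⟩ := hy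
    rw [mulVec_specialize] at hv0
    have hcongr : (fun j => scalarEval (scalars c σ) (v j)) =
        fun j => rename σ (specialize (eval₂Hom (Int.castRingHom k) c) v j) :=
      funext fun j => by rw [scalarEval_scalars, specialize_apply]
    refine Submodule.subset_span ⟨v, ⟨hv, ?_⟩, hcongr⟩
    funext i
    have h1 := RingHom.map_mulVec (scalarEval (scalars c σ)) (affineMatrix m p q) v i
    have h0 : map (eval₂Hom (Int.castRingHom k) c) ((affineMatrix m p q).mulVec v i) = 0 :=
      by simpa only [specialize_apply, Pi.zero_apply] using congrFun hv0 i
    rw [scalarEval_scalars, h0, map_zero] at h1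
    exact h1.symm
  | zero =>
    simp only [Pi.zero_apply, map_zero]
    exact Submodule.zero_mem _
  | add y z _ _ hy hz =>
    simp only [Pi.add_apply, map_add]
    exact Submodule.add_mem _ hy hz
  | smul r y _ hy =>
    simp only [Pi.smul_apply, smul_eq_mul, map_mul]
    exact Submodule.smul_mem _ (rename σ r) hy

theorem exists_linearMap_of_ker_le {R M N X : Type*} [CommRing R] [AddCommGroup M] [Module R M]
    [AddCommGroup N] [Module R N] [AddCommGroup X] [Module R X] {π : M →ₗ[R] N}
    (hπ : Function.Surjective π) (f : M →ₗ[R] X) (h : LinearMap.ker π ≤ LinearMap.ker f) :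
    ∃ g : N →ₗ[R] X, ∀ v, g (π v) = f v := by
  refine ⟨((LinearMap.ker π).liftQ f h).comp
    (π.quotKerEquivOfSurjective hπ).symm.toLinearMap, fun v => ?_⟩
  have : (π.quotKerEquivOfSurjective hπ).symm (π v) = (LinearMap.ker π).mkQ v := by
    rw [LinearEquiv.symm_apply_eq]
    rfl
  simp [this]

theorem existsUnique_linearMap_of_presentation {R N X ι : Type*} [CommRing R] [Fintype ι]
    [DecidableEq ι] [AddCommGroup N] [Module R N] [AddCommGroup X] [Module R X] {e : ι → N}
    (he : Function.Surjective (Fintype.linearCombination R e)) {x : ι → X}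
    (h : LinearMap.ker (Fintype.linearCombination R e) ≤
      LinearMap.ker (Fintype.linearCombination R x)) :
    ∃! t : N →ₗ[R] X, ∀ i, t (e i) = x i := by
  obtain ⟨g, hg⟩ := exists_linearMap_of_ker_le he _ h
  refine ⟨g, fun i => ?_, fun g' hg' => ?_⟩
  · simpa [Fintype.linearCombination_apply_single] using hg (Pi.single i 1)
  · ext y
    obtain ⟨v, rfl⟩ := he y
    rw [hg, Fintype.linearCombination_apply, Fintype.linearCombination_apply, map_sum]
    simp [hg']

/-- Here N has p generators and l relations, the image has q generators, and m variables occur. A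
vector v is a relation among the generators of the image exactly when (v, -u) is a syzygy of the
full matrix for some u. So the template vectors that become syzygies, cut to their first q
coordinates, present the image. -/
theorem exists_bound_of_presentation (m p q l : ℕ) :
    ∃ b : ℕ, ∀ (k : Type w) [Field k] (n : ℕ) (M N : ModuleCat.{w} (MvPolynomial (Fin n) k))
      (φ : M ⟶ N) (c : Fin p × Fin (q + l) × Option (Fin m) → k) (σ : Fin m → Fin n)
      (e : Fin p → N), Function.Injective σ →
      Function.Surjective (Fintype.linearCombination (MvPolynomial (Fin n) k) e) →
      (LinearMap.ker (Fintype.linearCombination (MvPolynomial (Fin n) k) e) =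
        Submodule.span (MvPolynomial (Fin n) k) (Set.range fun (j : Fin l) (i : Fin p) =>
          scalarEval (scalars c σ) (affineMatrix m p (q + l) i (Fin.natAdd q j)))) →
      (LinearMap.range φ.hom = Submodule.span (MvPolynomial (Fin n) k)
        (Set.range fun j : Fin q => ∑ i : Fin p,
          scalarEval (scalars c σ) (affineMatrix m p (q + l) i (Fin.castAdd l j)) • e i)) →
      ∃ Q : ColimitComputation (PolyModBasic k n),
        Q.Computes (morphismDiagram (ModuleCat.ofHom (LinearMap.range φ.hom).subtype)) ∧
        Q.size ≤ b := by
  classical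
  obtain ⟨T, hT⟩ := exists_template_affineMatrix.{w} m p (q + l)
  choose t₁ ht₁ using exists_represents.{w} (γ := Fin q)
    (C := Fin p × Fin (q + l) × Option (Fin m)) (D := Fin m)
  choose t₂ ht₂ using exists_represents.{w} (γ := Fin q ⊕ Fin p)
    (C := Fin p × Fin (q + l) × Option (Fin m)) (D := Fin m)
  -- Three families of candidate relations: those among the generators of the image, the expressions
  -- of these in the generators of N, and the relations of N.
  set Z₁ := (fun v : Fin (q + l) → _ => (t₁ fun j => v (Fin.castAdd l j)).map
    (Sum.inl : Fin q → Fin q ⊕ Fin p)) '' (T : Set _) 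
  set Z₂ := Set.range fun j : Fin q => t₂ (Sum.elim (Pi.single j 1)
    fun i => -affineMatrix m p (q + l) i (Fin.castAdd l j)) 
  set Z₃ := Set.range fun j : Fin l => t₂ (Sum.elim 0
    fun i => affineMatrix m p (q + l) i (Fin.natAdd q j)) 
  obtain ⟨s, hs, hfin, hclosed⟩ := exists_finite_isSubtermClosed
    (s := Z₁ ∪ Z₂ ∪ Z₃ ∪ Set.range gen)
    ((((T.finite_toSet.image _).union (Set.finite_range _)).union (Set.finite_range _)).union
      (Set.finite_range _))
  -- Two steps, at most 3|s| scalar gates, and three edges for each of at most |s| addition gates.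
  -- The set `s` is fixed before the field, the variables and the coefficients.
  refine ⟨2 + (3 * s.ncard + 3 * s.ncard), fun k _ n M N φ c σ e hσ he hker hrange => ?_⟩
  let B : Fin p → Fin (q + l) → MvPolynomial (Fin n) k :=
    fun i j => scalarEval (scalars c σ) (affineMatrix m p (q + l) i j)
  let y : Fin q → N := fun j => ∑ i, B i (Fin.castAdd l j) • e i
  have hy : ∀ j, y j ∈ LinearMap.range φ.hom := fun j => by
    rw [hrange]
    exact Submodule.subset_span ⟨j, rfl⟩
  let x₂ : Fin q ⊕ Fin p → N := Sum.elim y e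
  -- The zeros at the generators of N are placeholders: the core involves only the generators of the
  -- image.
  let x₁ : Fin q ⊕ Fin p → LinearMap.range φ.hom := Sum.elim (fun j => ⟨y j, hy j⟩) 0
  have hx : ∀ g ∈ Set.range (Sum.inl : Fin q → Fin q ⊕ Fin p),
      (LinearMap.range φ.hom).subtype (x₁ g) = x₂ g := by
    rintro _ ⟨j, rfl⟩
    rfl
  -- The choice of relations varies with the specialization, but inside the fixed set `s`. It
  -- contains all template vectors that become syzygies; any other candidate that vanishes in N is a
  -- true relation as well.
  set Z := {z | z ∈ Z₁ ∪ Z₂ ∪ Z₃ ∧ z.eval (scalars c σ) x₂ = 0} with hZ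
  have hZs : Z ⊆ s := fun z hz => hs (Or.inl hz.1)
  have hgen : ∀ g, gen g ∈ s := fun g => hs (Or.inr ⟨g, rfl⟩)
  have hcol : ∀ j, Fintype.linearCombination (MvPolynomial (Fin n) k) e
      (fun i => B i (Fin.natAdd q j)) = 0 := by
    intro j
    rw [← LinearMap.mem_ker, hker]
    exact Submodule.subset_span ⟨j, rfl⟩
  have hmul : ∀ x, ((affineMatrix m p (q + l)).map (scalarEval (scalars c σ))).mulVec x =
      (∑ j, x (Fin.castAdd l j) • fun i => B i (Fin.castAdd l j)) +
        ∑ j, x (Fin.natAdd q j) • fun i => B i (Fin.natAdd q j) := by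
    intro x
    funext i
    simp [Matrix.mulVec, dotProduct, Fin.sum_univ_add, B, mul_comm]
  have heval₂ : ∀ (X : Type w) [AddCommGroup X] [Module (MvPolynomial (Fin n) k) X] (x : Fin q ⊕ Fin p → X) (j : Fin q),
      (t₂ (Sum.elim (Pi.single j 1)
        fun i => -affineMatrix m p (q + l) i (Fin.castAdd l j))).eval (scalars c σ) x =
      x (Sum.inl j) - ∑ i, B i (Fin.castAdd l j) • x (Sum.inr i) := by
    intro X _ _ x j
    rw [ht₂ _ (MvPolynomial (Fin n) k) X (scalars c σ) x rfl, Fintype.sum_sum_type, Finset.sum_eq_single j]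
    · simp [B, sub_eq_add_neg]
    · intro j' _ hj
      simp [hj]
    · simp
  have heval₃ : ∀ (X : Type w) [AddCommGroup X] [Module (MvPolynomial (Fin n) k) X] (x : Fin q ⊕ Fin p → X) (j : Fin l),
      (t₂ (Sum.elim 0 fun i => affineMatrix m p (q + l) i (Fin.natAdd q j))).eval (scalars c σ) x =
      ∑ i, B i (Fin.natAdd q j) • x (Sum.inr i) := by
    intro X _ _ x j
    rw [ht₂ _ (MvPolynomial (Fin n) k) X (scalars c σ) x rfl, Fintype.sum_sum_type]
    simp [B]
  have h₂ : (LinearTerm.system s hfin Z (Set.range Sum.inl) (scalars c σ) (scalars_basic c σ)).IsUniversal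
      {u : s | u.1.UsesOnly Set.univ} (fun u : s => u.1.eval (scalars c σ) x₂) := by
    refine system_isUniversal hclosed hgen hZs _ x₂ (fun z hz _ => hz.2) ?_
    intro X _ _ x hxZ
    have hxe : LinearMap.ker (Fintype.linearCombination (MvPolynomial (Fin n) k) e) ≤
        LinearMap.ker (Fintype.linearCombination (MvPolynomial (Fin n) k) (x ∘ Sum.inr)) := by
      rw [hker, Submodule.span_le]
      rintro _ ⟨j, rfl⟩
      have h0 : ∑ i, B i (Fin.natAdd q j) • e i = 0 := hcol j
      have h1 := hxZ _ ⟨Or.inr ⟨j, rfl⟩, (heval₃ N x₂ j).trans h0⟩ (usesOnly_univ _)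
      rw [heval₃ X x j] at h1
      exact h1
    obtain ⟨t, ht, huniq⟩ := existsUnique_linearMap_of_presentation he hxe
    refine ⟨t, ?_, fun t' ht' => huniq t' fun i => ht' (Sum.inr i) trivial⟩
    rintro (j | i) -
    · have h1 := hxZ _ ⟨Or.inl (Or.inr ⟨j, rfl⟩), (heval₂ N x₂ j).trans (sub_self _)⟩
        (usesOnly_univ _)
      rw [heval₂ X x j, sub_eq_zero] at h1
      rw [h1]
      change t (∑ i, B i (Fin.castAdd l j) • e i) = _
      rw [map_sum]
      exact Finset.sum_congr rfl fun i _ => by rw [map_smul, ht i]; rfl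
    · exact ht i
  have h₁ : (LinearTerm.system s hfin Z (Set.range Sum.inl) (scalars c σ) (scalars_basic c σ)).IsUniversal
      {u : s | u.1.UsesOnly (Set.range Sum.inl)} (fun u : s => u.1.eval (scalars c σ) x₁) := by
    refine system_isUniversal hclosed hgen hZs _ x₁ (fun z hz hK => ?_) ?_
    -- A term in the generators of the image that vanishes in N vanishes in the image.
    · apply (LinearMap.range φ.hom).injective_subtype
      rw [map_eval (scalars c σ) _ hx hK, hz.2, map_zero]
    intro X _ _ x hxZ
    have hsurj : Function.Surjective (Fintype.linearCombination (MvPolynomial (Fin n) k)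
        fun j => (⟨y j, hy j⟩ : LinearMap.range φ.hom)) := by
      rw [← LinearMap.range_eq_top, eq_top_iff]
      rintro ⟨z, hz⟩ -
      have hz' := hz
      rw [hrange, ← Fintype.range_linearCombination] at hz'
      obtain ⟨v, hv⟩ := hz'
      refine ⟨v, Subtype.ext ?_⟩
      refine Eq.trans ?_ hv
      rw [Fintype.linearCombination_apply, Fintype.linearCombination_apply]
      simp [y, B]
    have hle : LinearMap.ker (Fintype.linearCombination (MvPolynomial (Fin n) k)
        fun j => (⟨y j, hy j⟩ : LinearMap.range φ.hom)) ≤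
        LinearMap.ker (Fintype.linearCombination (MvPolynomial (Fin n) k) (x ∘ Sum.inl)) := by
      intro v hv
      have hv0 : ∑ j, v j • y j = 0 := by
        have h0 := congrArg (LinearMap.range φ.hom).subtype (LinearMap.mem_ker.1 hv)
        simpa [Fintype.linearCombination_apply] using h0
      have hu : (∑ j, v j • fun i => B i (Fin.castAdd l j)) ∈
          LinearMap.ker (Fintype.linearCombination (MvPolynomial (Fin n) k) e) := by
        rw [LinearMap.mem_ker, map_sum, ← hv0]
        exact Finset.sum_congr rfl fun j _ => map_smul _ _ _
      rw [hker, ← Fintype.range_linearCombination] at hu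
      obtain ⟨u, hu⟩ := hu
      rw [Fintype.linearCombination_apply] at hu
      -- Here `u` writes the combination with coefficients `v` through the relations of N, so the
      -- two blocks of columns cancel.
      have hx' := hT k n c σ hσ (Fin.append v (-u)) (by
        rw [hmul]
        simp only [Fin.append_left, Fin.append_right, Pi.neg_apply, neg_smul,
          Finset.sum_neg_distrib]
        rw [← hu]
        exact add_neg_cancel _)
      have h1 : Fin.append v (-u) ∈ LinearMap.ker
          ((Fintype.linearCombination (MvPolynomial (Fin n) k) (x ∘ Sum.inl)).comp
            (LinearMap.funLeft (MvPolynomial (Fin n) k) (MvPolynomial (Fin n) k)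
              (Fin.castAdd l : Fin q → Fin (q + l)))) := by
        refine Submodule.span_le.2 ?_ hx'
        rintro _ ⟨t, ⟨ht, ht0⟩, rfl⟩
        have h0 : ∑ j, scalarEval (scalars c σ) (t (Fin.castAdd l j)) • y j = 0 := by
          rw [hmul] at ht0
          have h1 := congrArg (Fintype.linearCombination (MvPolynomial (Fin n) k) e) ht0
          simp only [map_add, map_sum, map_smul, hcol, smul_zero, Finset.sum_const_zero,
            add_zero, map_zero] at h1
          exact h1
        have h1 := hxZ _ ⟨Or.inl (Or.inl ⟨t, ht, rfl⟩), by
          refine (LinearTerm.eval_map _ _ _ _).trans ?_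
          rw [ht₁ _ (MvPolynomial (Fin n) k) N (scalars c σ) _ rfl]
          exact h0⟩ (usesOnly_map _ _)
        rw [LinearTerm.eval_map, ht₁ _ (MvPolynomial (Fin n) k) X (scalars c σ) _ rfl] at h1
        exact h1
      rw [LinearMap.mem_ker, LinearMap.comp_apply] at h1
      rw [LinearMap.mem_ker, ← h1]
      congr 1
      funext j
      exact (Fin.append_left v (-u) j).symm
    obtain ⟨t, ht, huniq⟩ := existsUnique_linearMap_of_presentation hsurj hle
    refine ⟨t, ?_, fun t' ht' => huniq t' fun i => ht' (Sum.inl i) ⟨i, rfl⟩⟩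
    rintro _ ⟨j, rfl⟩
    exact ht j
  obtain ⟨Q, hQ, hsize⟩ := GateSystem.exists_computes (W₁ := ModuleCat.of _ (LinearMap.range φ.hom))
    (W₂ := N) (f := ModuleCat.ofHom (LinearMap.range φ.hom).subtype) h₁
    (by rwa [Set.eq_univ_of_forall fun u => usesOnly_univ _] at h₂)
    (fun u hu => map_eval (scalars c σ) (LinearMap.range φ.hom).subtype hx hu)
  refine ⟨Q, hQ, hsize.trans (Nat.add_le_add_left ?_ 2)⟩
  exact Nat.add_le_add card_system_E_le (Nat.mul_le_mul_left 3 card_system_G_le)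

end Bound

/-! ### Constructivity: every apex is a colimit of a subdiagram of `D_0`. -/

section Restriction

variable {C : Type u} [Category.{v} C] {V : Type} [Quiver.{0} V]

theorem IsColimitOn.hom_ext {D : V ⥤q C} {J : DiSubgraph V} {W : C}
    {φ : ∀ a : J.verts, D.obj a.1 ⟶ W} (h : IsColimitOn D J W φ) {X : C} {t t' : W ⟶ X}
    (ht : ∀ a, φ a ≫ t = φ a ≫ t') : t = t' := by
  obtain ⟨r, -, hr⟩ := h.2 X (fun a => φ a ≫ t') fun e he => by rw [← Category.assoc, h.1 e he]
  exact (hr t ht).trans (hr t' fun _ => rfl).symm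

namespace ColimitComputation

variable {A : MorphismProperty C} (P : ColimitComputation A)

theorem shape_mono {i j : Fin (P.steps + 1)} (h : i ≤ j) :
    (P.shape i).verts ⊆ (P.shape j).verts ∧ (P.shape i).edges ⊆ (P.shape j).edges := by
  have key : ∀ d (i j : Fin (P.steps + 1)), j.val = i.val + d →
      (P.shape i).verts ⊆ (P.shape j).verts ∧ (P.shape i).edges ⊆ (P.shape j).edges := by
    intro d
    induction d with
    | zero =>
      intro i j h
      obtain rfl : j = i := Fin.ext h
      exact ⟨subset_rfl, subset_rfl⟩
    | succ d ih =>
      intro i j h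
      have hj : i.val + d < P.steps := by have := j.isLt; omega
      obtain ⟨h1, h2⟩ := ih i (Fin.castSucc ⟨i.val + d, hj⟩) rfl
      obtain rfl : j = Fin.succ ⟨i.val + d, hj⟩ := Fin.ext h
      constructor
      · rw [P.verts_succ]
        exact h1.trans (Set.subset_insert _ _)
      · rw [P.edges_succ]
        exact h2.trans Set.subset_union_left
  exact key (j.val - i.val) i j (by have : i.val ≤ j.val := h; omega)

theorem mem_shape_verts {i : Fin (P.steps + 1)} {a : P.V} (ha : a ∈ (P.shape i).verts) :
    a ∈ (P.shape 0).verts ∨ ∃ l : Fin P.steps, l.castSucc < i ∧ a = P.apex l := by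
  induction i using Fin.induction with
  | zero => exact Or.inl ha
  | succ i ih =>
    rw [P.verts_succ] at ha
    rcases ha with rfl | ha
    · exact Or.inr ⟨i, Fin.castSucc_lt_succ, rfl⟩
    · exact (ih ha).imp id fun ⟨l, hl, h⟩ => ⟨l, hl.trans Fin.castSucc_lt_succ, h⟩

theorem mem_shape_edges {i : Fin (P.steps + 1)} {e : Quiver.Total P.V}
    (he : e ∈ (P.shape i).edges) :
    e ∈ (P.shape 0).edges ∨ ∃ l : Fin P.steps, l.castSucc < i ∧ ∃ a : (P.sub l).verts,
      e = Quiver.Total.mk a.1 (P.apex l) (P.leg l a) := by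
  induction i using Fin.induction with
  | zero => exact Or.inl he
  | succ i ih =>
    rw [P.edges_succ] at he
    rcases he with he | ⟨a, rfl⟩
    · exact (ih he).imp id fun ⟨l, hl, h⟩ => ⟨l, hl.trans Fin.castSucc_lt_succ, h⟩
    · exact Or.inr ⟨i, Fin.castSucc_lt_succ, a, rfl⟩

theorem apex_mem_shape {l : Fin P.steps} {i : Fin (P.steps + 1)} :
    P.apex l ∈ (P.shape i).verts ↔ l.castSucc < i := by
  constructor
  · intro h
    by_contra hlt
    exact P.apex_new l ((P.shape_mono (not_lt.1 hlt)).1 h)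
  · intro h
    refine (P.shape_mono (i := l.succ) (Fin.castSucc_lt_iff_succ_le.1 h)).1 ?_
    rw [P.verts_succ]
    exact Set.mem_insert _ _

theorem apex_notMem_shape_zero (l : Fin P.steps) : P.apex l ∉ (P.shape 0).verts := fun h =>
  absurd (P.apex_mem_shape.1 h) (Fin.not_lt_zero _)

theorem apex_injective : Function.Injective P.apex := by
  intro i j h
  by_contra hne
  rcases lt_or_gt_of_ne hne with hlt | hlt
  · exact P.apex_new j (by rw [← h]; exact P.apex_mem_shape.2 (Fin.castSucc_lt_castSucc_iff.2 hlt))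
  · exact P.apex_new i (by rw [h]; exact P.apex_mem_shape.2 (Fin.castSucc_lt_castSucc_iff.2 hlt))

theorem lt_of_apex_mem_sub {l i : Fin P.steps} (h : P.apex l ∈ (P.sub i).verts) : l < i :=
  Fin.castSucc_lt_castSucc_iff.1 (P.apex_mem_shape.1 ((P.sub_full i).1.1 h))

theorem sub_le_sub {l i : Fin P.steps} (h : P.apex l ∈ (P.sub i).verts) : P.sub l ≤ P.sub i :=
  P.constructive l i (P.lt_of_apex_mem_sub h) h

/-- Constructivity provides the endpoints of the leg, and fullness of the chosen subgraph provides
the edge. -/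
theorem leg_mem_sub_edges {l i : Fin P.steps} (h : P.apex l ∈ (P.sub i).verts)
    (a : (P.sub l).verts) :
    Quiver.Total.mk a.1 (P.apex l) (P.leg l a) ∈ (P.sub i).edges := by
  refine (P.sub_full i).2 _ ?_ ((P.sub_le_sub h).1 a.2) h
  refine (P.shape_mono (i := l.succ) ?_).2 ?_
  · exact Fin.castSucc_lt_iff_succ_le.1 (Fin.castSucc_lt_castSucc_iff.2 (P.lt_of_apex_mem_sub h))
  · rw [P.edges_succ]
    exact Or.inr ⟨a, rfl⟩

/-- A leg out of an earlier apex is compatible with the legs. -/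
theorem map_leg_comp_map_leg {l i : Fin P.steps} (h : P.apex l ∈ (P.sub i).verts)
    (a : (P.sub l).verts) :
    P.diagram.map (P.leg l a) ≫ P.diagram.map (P.leg i ⟨P.apex l, h⟩) =
      P.diagram.map (P.leg i ⟨a.1, (P.sub_le_sub h).1 a.2⟩) :=
  (P.isColimit i).1 _ (P.leg_mem_sub_edges h a)

/-- The part of the subdiagram chosen in a step that belongs to the initial diagram. -/
def basicSub (i : Fin P.steps) : DiSubgraph P.V where
  verts := (P.sub i).verts ∩ (P.shape 0).verts
  edges := (P.sub i).edges ∩ (P.shape 0).edges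
  left_mem e he := ⟨(P.sub i).left_mem e he.1, (P.shape 0).left_mem e he.2⟩
  right_mem e he := ⟨(P.sub i).right_mem e he.1, (P.shape 0).right_mem e he.2⟩

/-- The legs at the vertices of the initial diagram. -/
def basicLeg (i : Fin P.steps) (a : (P.basicSub i).verts) :
    P.diagram.obj a.1 ⟶ P.diagram.obj (P.apex i) :=
  P.diagram.map (P.leg i ⟨a.1, a.2.1⟩)

theorem isCoconeOn_basicSub (i : Fin P.steps) :
    IsCoconeOn P.diagram (P.basicSub i) (P.diagram.obj (P.apex i)) (P.basicLeg i) :=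
  fun e he => (P.isColimit i).1 e he.1

/-- The diagram that produced the apex `a` lies in `sub i`, so the cocone restricts to its basic
part and induces the map. The second clause ranges over all `l` with apex `a`, with a transport, so
that one choice function covers all vertices. -/
theorem exists_extension {i : Fin P.steps}
    (ih : ∀ l < i, IsColimitOn P.diagram (P.basicSub l) (P.diagram.obj (P.apex l)) (P.basicLeg l))
    {X : C} {ψ : ∀ a : (P.basicSub i).verts, P.diagram.obj a.1 ⟶ X}
    (hψ : IsCoconeOn P.diagram (P.basicSub i) X ψ) (a : P.V) (ha : a ∈ (P.sub i).verts) :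
    ∃ f : P.diagram.obj a ⟶ X, (∀ h : a ∈ (P.basicSub i).verts, f = ψ ⟨a, h⟩) ∧
      ∀ (l : Fin P.steps) (b : (P.basicSub l).verts) (hb : b.1 ∈ (P.basicSub i).verts)
        (hal : P.apex l = a),
        P.basicLeg l b ≫ eqToHom (congrArg P.diagram.obj hal) ≫ f = ψ ⟨b.1, hb⟩ := by
  rcases P.mem_shape_verts ((P.sub_full i).1.1 ha) with h0 | ⟨l, hl, rfl⟩
  · refine ⟨ψ ⟨a, ha, h0⟩, fun _ => rfl, ?_⟩
    rintro l b hb rfl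
    exact absurd h0 (P.apex_notMem_shape_zero l)
  · have hle := P.sub_le_sub ha
    obtain ⟨t, ht, -⟩ := (ih l (P.lt_of_apex_mem_sub ha)).2 X
      (fun b => ψ ⟨b.1, hle.1 b.2.1, b.2.2⟩) fun e he => hψ e ⟨hle.2 he.1, he.2⟩
    refine ⟨t, fun h => absurd h.2 (P.apex_notMem_shape_zero l), ?_⟩
    intro l' b hb hal
    obtain rfl := P.apex_injective hal
    rw [eqToHom_refl, Category.id_comp]
    exact ht b

/-- Strong induction on the step: cocones on the basic part extend uniquely to `sub i`.
Compatibility along a leg between two earlier apexes is tested on the basic vertices below its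
source, where both sides reduce to `ψ`. -/
theorem isColimitOn_basicSub (i : Fin P.steps) :
    IsColimitOn P.diagram (P.basicSub i) (P.diagram.obj (P.apex i)) (P.basicLeg i) := by
  induction i using WellFoundedLT.induction with
  | ind i ih =>
  refine ⟨P.isCoconeOn_basicSub i, fun X ψ hψ => ?_⟩
  have hbasic : ∀ {l}, P.apex l ∈ (P.sub i).verts → ∀ b : (P.basicSub l).verts,
      b.1 ∈ (P.basicSub i).verts := fun h b => ⟨(P.sub_le_sub h).1 b.2.1, b.2.2⟩
  choose ψ' h1 h2 using P.exists_extension ih hψ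
  have h2' : ∀ (l : Fin P.steps) (hl : P.apex l ∈ (P.sub i).verts) (b : (P.basicSub l).verts),
      P.basicLeg l b ≫ ψ' _ hl = ψ ⟨b.1, hbasic hl b⟩ := by
    intro l hl b
    have := h2 _ hl l b (hbasic hl b) rfl
    rwa [eqToHom_refl, Category.id_comp] at this
  have hcocone : IsCoconeOn P.diagram (P.sub i) X fun a => ψ' a.1 a.2 := by
    intro e he
    rcases P.mem_shape_edges ((P.sub_full i).1.2 he) with h0 | ⟨l, hl, a, rfl⟩
    · have hle := (P.basicSub i).left_mem e ⟨he, h0⟩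
      have hri := (P.basicSub i).right_mem e ⟨he, h0⟩
      change P.diagram.map e.hom ≫ ψ' e.right _ = ψ' e.left _
      rw [h1 _ _ hle, h1 _ _ hri]
      exact hψ e ⟨he, h0⟩
    · have hr : P.apex l ∈ (P.sub i).verts := (P.sub i).right_mem _ he
      have hli := P.lt_of_apex_mem_sub hr
      have ha : a.1 ∈ (P.sub i).verts := (P.sub_le_sub hr).1 a.2
      change P.diagram.map (P.leg l a) ≫ ψ' (P.apex l) hr = ψ' a.1 ha
      rcases P.mem_shape_verts ((P.sub_full l).1.1 a.2) with h0 | ⟨j, -, hj⟩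
      · rw [h1 a.1 ha ⟨ha, h0⟩]
        exact h2' l hr ⟨a.1, a.2, h0⟩
      · obtain ⟨a, hal⟩ := a
        obtain rfl : a = P.apex j := hj
        have hji := P.lt_of_apex_mem_sub ha
        refine (ih j hji).hom_ext fun b => ?_
        rw [h2' j ha b, ← Category.assoc]
        have h3 := P.map_leg_comp_map_leg hal ⟨b.1, b.2.1⟩
        refine (congrArg (· ≫ ψ' (P.apex l) hr) h3).trans ?_
        exact h2' l hr ⟨b.1, (P.sub_le_sub hal).1 b.2.1, b.2.2⟩
  obtain ⟨t, ht, huniq⟩ := (P.isColimit i).2 X _ hcocone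
  refine ⟨t, fun a => (ht ⟨a.1, a.2.1⟩).trans (h1 _ _ a.2), fun t' ht' => huniq t' ?_⟩
  rintro ⟨a, ha⟩
  rcases P.mem_shape_verts ((P.sub_full i).1.1 ha) with h0 | ⟨j, -, rfl⟩
  · exact (ht' ⟨a, ha, h0⟩).trans (h1 _ _ ⟨ha, h0⟩).symm
  · refine (ih j (P.lt_of_apex_mem_sub ha)).hom_ext fun b => ?_
    rw [h2' j ha b, ← Category.assoc]
    exact (congrArg (· ≫ t') (P.map_leg_comp_map_leg ha ⟨b.1, b.2.1⟩)).trans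
      (ht' ⟨b.1, hbasic ha b⟩)

end ColimitComputation

end Restriction

/-! ### Standard generators of the basic modules and matrices of the basic morphisms. -/

section Generators

variable {R : Type w} [CommRing R]

open Classical in
/-- The standard generators of `R` and of `R ⊕ R`, padded by zeros. -/
noncomputable def stdGen (X : ModuleCat.{w} R) : Fin 2 → X :=
  if h : X = ModuleCat.of R R then fun i => (eqToHom h.symm).hom (![(1 : R), 0] i)
  else if h : X = ModuleCat.of R (R × R) then
    fun i => (eqToHom h.symm).hom (![((1 : R), (0 : R)), (0, 1)] i)
  else 0

theorem stdGen_self : stdGen (ModuleCat.of R R) = ![(1 : R), 0] := by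
  rw [stdGen, dif_pos rfl]
  rfl

/-- Ranks show that R ⊕ R is a different object from R, so the second branch of `stdGen` applies.
The generators depend on the object alone, so all edges that meet at a vertex use the same ones. -/
theorem stdGen_prod [Nontrivial R] :
    stdGen (ModuleCat.of R (R × R)) = ![((1 : R), (0 : R)), (0, 1)] := by
  have h : ModuleCat.of R (R × R) ≠ ModuleCat.of R R := by
    intro h
    have h1 := (eqToIso h).toLinearEquiv.finrank_eq
    change Module.finrank R (R × R) = Module.finrank R R at h1
    rw [Module.finrank_prod, Module.finrank_self] at h1
    omega
  rw [stdGen, dif_neg h, dif_pos rfl]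
  rfl

/-- The standard generators generate `X`, subject only to the relations `z i • stdGen X i = 0`. -/
structure IsStdPresented (X : ModuleCat.{w} R) (z : Fin 2 → R) : Prop where
  zero_or_one : ∀ i, z i = 0 ∨ z i = 1
  smul_eq_zero : ∀ i, z i • stdGen X i = 0
  span_eq_top : Submodule.span R (Set.range (stdGen X)) = ⊤
  exists_lift : ∀ (Y : ModuleCat.{w} R) (y : Fin 2 → Y), (∀ i, z i • y i = 0) →
    ∃ t : X ⟶ Y, ∀ i, t.hom (stdGen X i) = y i

theorem isStdPresented_self : IsStdPresented (ModuleCat.of R R) ![0, 1] where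
  zero_or_one i := by fin_cases i <;> simp
  smul_eq_zero i := by rw [stdGen_self]; fin_cases i <;> simp
  span_eq_top := by
    rw [eq_top_iff, stdGen_self]
    intro x _
    have h : x = (show R from x) • (1 : R) := (mul_one (show R from x)).symm
    rw [h]
    exact Submodule.smul_mem _ _ (Submodule.subset_span ⟨0, rfl⟩)
  exists_lift Y y hy := by
    refine ⟨ModuleCat.ofHom (LinearMap.toSpanSingleton R Y (y 0)), fun i => ?_⟩
    rw [stdGen_self]
    fin_cases i
    · simp
    · simpa using (hy 1).symm

theorem isStdPresented_prod [Nontrivial R] :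
    IsStdPresented (ModuleCat.of R (R × R)) ![0, 0] where
  zero_or_one i := by fin_cases i <;> simp
  smul_eq_zero i := by fin_cases i <;> simp
  span_eq_top := by
    rw [eq_top_iff, stdGen_prod]
    rintro ⟨x, y⟩ _
    have h : ((x, y) : R × R) = x • ((1 : R), (0 : R)) + y • ((0 : R), (1 : R)) := by simp
    rw [h]
    exact Submodule.add_mem _ (Submodule.smul_mem _ _ (Submodule.subset_span ⟨0, rfl⟩))
      (Submodule.smul_mem _ _ (Submodule.subset_span ⟨1, rfl⟩))
  exists_lift Y y hy := by
    refine ⟨ModuleCat.ofHom ((LinearMap.toSpanSingleton R Y (y 0)).coprod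
      (LinearMap.toSpanSingleton R Y (y 1))), fun i => ?_⟩
    rw [stdGen_prod]
    fin_cases i <;> simp

/-- In the zero module the values of `stdGen` are irrelevant; both generators are killed by 1. -/
theorem isStdPresented_punit : IsStdPresented (ModuleCat.of R PUnit.{w + 1}) ![1, 1] where
  zero_or_one i := by fin_cases i <;> simp
  smul_eq_zero i := Subsingleton.elim (α := PUnit.{w + 1}) _ _
  span_eq_top := by
    rw [eq_top_iff]
    intro x _
    rw [show x = 0 from Subsingleton.elim (α := PUnit.{w + 1}) _ _]
    exact Submodule.zero_mem _
  exists_lift Y y hy := by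
    refine ⟨0, fun i => ?_⟩
    have := hy i
    fin_cases i <;> simpa using this.symm

variable {k : Type w} [Field k] {n : ℕ}

/-- The affine linear forms in the variables from `J`. -/
noncomputable def affineForms (k : Type w) [Field k] {n : ℕ} (J : Finset (Fin n)) :
    Submodule k (MvPolynomial (Fin n) k) :=
  Submodule.span k (insert 1 (MvPolynomial.X '' (J : Set (Fin n))))

theorem one_mem_affineForms (J : Finset (Fin n)) : 1 ∈ affineForms k J :=
  Submodule.subset_span (Set.mem_insert _ _)

theorem C_mem_affineForms (c : k) (J : Finset (Fin n)) : MvPolynomial.C c ∈ affineForms k J := by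
  have : (MvPolynomial.C c : MvPolynomial (Fin n) k) = c • 1 := by
    rw [MvPolynomial.smul_eq_C_mul, mul_one]
  rw [this]
  exact Submodule.smul_mem _ _ (one_mem_affineForms J)

theorem X_mem_affineForms {i : Fin n} {J : Finset (Fin n)} (h : i ∈ J) :
    MvPolynomial.X i ∈ affineForms k J :=
  Submodule.subset_span (Or.inr ⟨i, h, rfl⟩)

theorem affineForms_mono {J J' : Finset (Fin n)} (h : J ⊆ J') :
    affineForms k J ≤ affineForms k J' :=
  Submodule.span_mono (Set.insert_subset_insert (Set.image_mono (Finset.coe_subset.2 h)))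

theorem PolyModBasic.exists_isStdPresented {X Y : ModuleCat.{w} (MvPolynomial (Fin n) k)}
    {f : X ⟶ Y} (hf : PolyModBasic k n f) :
    (∃ z, IsStdPresented X z) ∧ ∃ z, IsStdPresented Y z := by
  cases hf with
  | var | const => exact ⟨⟨_, isStdPresented_self⟩, ⟨_, isStdPresented_self⟩⟩
  | inl | inr | diag => exact ⟨⟨_, isStdPresented_self⟩, ⟨_, isStdPresented_prod⟩⟩
  | add => exact ⟨⟨_, isStdPresented_prod⟩, ⟨_, isStdPresented_self⟩⟩
  | zero => exact ⟨⟨_, isStdPresented_self⟩, ⟨_, isStdPresented_punit⟩⟩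

theorem PolyModBasic.exists_matrix {X Y : ModuleCat.{w} (MvPolynomial (Fin n) k)}
    {f : X ⟶ Y} (hf : PolyModBasic k n f) :
    ∃ J : Finset (Fin n), J.card ≤ 1 ∧ ∃ a : Fin 2 → Fin 2 → MvPolynomial (Fin n) k,
      (∀ i j, a i j ∈ affineForms k J) ∧ ∀ i, f.hom (stdGen X i) = ∑ j, a i j • stdGen Y j := by
  have h0 : ∀ J : Finset (Fin n), 0 ∈ affineForms k J := fun J => Submodule.zero_mem _
  have h1 : ∀ J : Finset (Fin n), 1 ∈ affineForms k J := one_mem_affineForms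
  cases hf with
  | var l =>
    refine ⟨{l}, by simp, ![![MvPolynomial.X l, 0], ![0, 0]], fun i j => ?_, fun i => ?_⟩
    · have := X_mem_affineForms (k := k) (Finset.mem_singleton_self l)
      fin_cases i <;> fin_cases j <;> simp [h0, this]
    · rw [stdGen_self]
      fin_cases i <;> simp [Fin.sum_univ_two]
  | const c =>
    refine ⟨∅, by simp, ![![MvPolynomial.C c, 0], ![0, 0]], fun i j => ?_, fun i => ?_⟩
    · have := C_mem_affineForms c (∅ : Finset (Fin n))
      fin_cases i <;> fin_cases j <;> simp [h0, this]
    · rw [stdGen_self]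
      fin_cases i <;> simp [Fin.sum_univ_two]
  | inl =>
    refine ⟨∅, by simp, ![![1, 0], ![0, 0]], fun i j => ?_, fun i => ?_⟩
    · fin_cases i <;> fin_cases j <;> simp [h0, h1]
    · rw [stdGen_self, stdGen_prod]
      fin_cases i <;> simp [Fin.sum_univ_two]
  | inr =>
    refine ⟨∅, by simp, ![![0, 1], ![0, 0]], fun i j => ?_, fun i => ?_⟩
    · fin_cases i <;> fin_cases j <;> simp [h0, h1]
    · rw [stdGen_self, stdGen_prod]
      fin_cases i <;> simp [Fin.sum_univ_two]
  | diag =>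
    refine ⟨∅, by simp, ![![1, 1], ![0, 0]], fun i j => ?_, fun i => ?_⟩
    · fin_cases i <;> fin_cases j <;> simp [h0, h1]
    · rw [stdGen_self, stdGen_prod]
      fin_cases i <;> simp [Fin.sum_univ_two]
  | add =>
    refine ⟨∅, by simp, ![![1, 0], ![1, 0]], fun i j => ?_, fun i => ?_⟩
    · fin_cases i <;> fin_cases j <;> simp [h0, h1]
    · rw [stdGen_self, stdGen_prod]
      fin_cases i <;> simp [Fin.sum_univ_two]
  | zero =>
    refine ⟨∅, by simp, 0, fun i j => h0 _, fun i => ?_⟩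
    exact Subsingleton.elim (α := PUnit.{w + 1}) _ _

end Generators

/-! ### Presentation of a colimit by generators and relations. -/

section Presentation

variable {R : Type w} [CommRing R] {V : Type} [Quiver.{0} V] {D : V ⥤q ModuleCat.{w} R}
  {J : DiSubgraph V} {W : ModuleCat.{w} R} {leg : ∀ a : J.verts, D.obj a.1 ⟶ W}

/-- The images of the standard generators in the apex of a cocone. -/
noncomputable def apexGen (leg : ∀ a : J.verts, D.obj a.1 ⟶ W) (p : J.verts × Fin 2) : W :=
  (leg p.1).hom (stdGen _ p.2)

open Classical in
/-- The relations between the images of the standard generators in the colimit: those of the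
modules at the vertices and those coming from the edges. -/
noncomputable def apexRel (J : DiSubgraph V) (z : J.verts → Fin 2 → R)
    (a : J.edges → Fin 2 → Fin 2 → R) :
    (J.verts × Fin 2) ⊕ (J.edges × Fin 2) → (J.verts × Fin 2 → R)
  | .inl p => Pi.single p (z p.1 p.2)
  | .inr (e, i) => Pi.single (⟨e.1.left, J.left_mem _ e.2⟩, i) 1 -
      ∑ j, Pi.single (⟨e.1.right, J.right_mem _ e.2⟩, j) (a e i j)

theorem hom_ext_stdGen {X Y : ModuleCat.{w} R} {z : Fin 2 → R} (hX : IsStdPresented X z)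
    {f g : X ⟶ Y} (h : ∀ i, f.hom (stdGen X i) = g.hom (stdGen X i)) : f = g := by
  apply ModuleCat.hom_ext
  refine LinearMap.ext_on_range (v := stdGen X) hX.span_eq_top h

/-- The projection to the quotient by the span kills every leg, hence is zero. -/
theorem surjective_apexGen [Fintype J.verts] (h : IsColimitOn D J W leg)
    {z : J.verts → Fin 2 → R} (hz : ∀ a : J.verts, IsStdPresented (D.obj a.1) (z a)) :
    Function.Surjective (Fintype.linearCombination R (apexGen leg)) := by
  rw [← LinearMap.range_eq_top, Fintype.range_linearCombination]
  have h0 : ModuleCat.ofHom (Submodule.span R (Set.range (apexGen leg))).mkQ = 0 := by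
    refine h.hom_ext fun a => hom_ext_stdGen (hz a) fun i => ?_
    refine (Submodule.Quotient.mk_eq_zero _).2 (Submodule.subset_span ⟨(a, i), rfl⟩)
  rw [eq_top_iff]
  intro x _
  exact (Submodule.Quotient.mk_eq_zero _).1 (congrArg (fun f => f.hom x) h0)

/-- The module presented by `apexRel` carries a cocone. The induced map from the colimit sends each
combination of generators to its class, so a combination that is zero in the colimit lies in the
span of the relations. -/
theorem ker_apexGen [Fintype J.verts] (h : IsColimitOn D J W leg)
    {z : J.verts → Fin 2 → R} (hz : ∀ a : J.verts, IsStdPresented (D.obj a.1) (z a))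
    {a : J.edges → Fin 2 → Fin 2 → R}
    (ha : ∀ (e : J.edges) i, (D.map e.1.hom).hom (stdGen _ i) = ∑ j, a e i j • stdGen _ j) :
    LinearMap.ker (Fintype.linearCombination R (apexGen leg)) =
      Submodule.span R (Set.range (apexRel J z a)) := by
  classical
  apply le_antisymm
  · set S := Submodule.span R (Set.range (apexRel J z a)) with hS
    have hex : ∀ b : J.verts, ∃ ψ : D.obj b.1 ⟶ ModuleCat.of R ((J.verts × Fin 2 → R) ⧸ S),
        ∀ i, ψ.hom (stdGen _ i) = S.mkQ (Pi.single (b, i) 1) := by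
      intro b
      refine (hz b).exists_lift _ _ fun i => ?_
      rw [← map_smul, ← Pi.single_smul, smul_eq_mul, mul_one]
      refine (Submodule.Quotient.mk_eq_zero _).2 (Submodule.subset_span ⟨.inl (b, i), ?_⟩)
      simp [apexRel]
    choose ψ hψ using hex
    obtain ⟨t, ht, -⟩ := h.2 _ ψ (by
      intro e he
      refine hom_ext_stdGen (hz ⟨e.left, J.left_mem e he⟩) fun i => ?_
      rw [hψ, ModuleCat.hom_comp, LinearMap.comp_apply, ha ⟨e, he⟩ i, map_sum]
      simp only [map_smul]
      have h1 : S.mkQ (apexRel J z a (.inr (⟨e, he⟩, i))) = 0 :=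
        (Submodule.Quotient.mk_eq_zero _).2 (Submodule.subset_span ⟨_, rfl⟩)
      rw [apexRel, map_sub, map_sum, sub_eq_zero] at h1
      rw [h1]
      refine Finset.sum_congr rfl fun j _ => ?_
      rw [hψ ⟨e.right, J.right_mem e he⟩ j, ← map_smul, ← Pi.single_smul, smul_eq_mul, mul_one])
    have htv : ∀ v : J.verts × Fin 2 → R,
        t.hom (Fintype.linearCombination R (apexGen leg) v) = S.mkQ v := by
      intro v
      have h2 : ∀ p, t.hom (apexGen leg p) = S.mkQ (Pi.single p 1) := fun p =>
        (congrArg (fun f => f.hom (stdGen _ p.2)) (ht p.1)).trans (hψ p.1 p.2)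
      conv_rhs => rw [← Finset.univ_sum_single v]
      rw [Fintype.linearCombination_apply, map_sum, map_sum]
      refine Finset.sum_congr rfl fun p _ => ?_
      rw [map_smul, h2, ← map_smul, ← Pi.single_smul, smul_eq_mul, mul_one]
    intro v hv
    have h3 := htv v
    rw [LinearMap.mem_ker.1 hv, map_zero] at h3
    exact (Submodule.Quotient.mk_eq_zero _).1 h3.symm
  · rw [Submodule.span_le]
    rintro _ ⟨⟨b, i⟩ | ⟨e, i⟩, rfl⟩
    · rw [SetLike.mem_coe, LinearMap.mem_ker, apexRel, Fintype.linearCombination_apply_single]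
      change z b i • (leg b).hom (stdGen _ i) = 0
      rw [← map_smul, (hz b).smul_eq_zero, map_zero]
    · rw [SetLike.mem_coe, LinearMap.mem_ker, apexRel, map_sub, map_sum,
        Fintype.linearCombination_apply_single, one_smul, sub_eq_zero]
      simp only [Fintype.linearCombination_apply_single]
      have h1 := congrArg (fun f => f.hom (stdGen _ i)) (h.1 e.1 e.2)
      refine h1.symm.trans ?_
      rw [ModuleCat.hom_comp, LinearMap.comp_apply, ha e i, map_sum]
      exact Finset.sum_congr rfl fun j _ => map_smul _ _ _

end Presentation

/-! ### Bounded presentations extracted from a computation. -/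

section Data

variable {k : Type w} [Field k] {n : ℕ}

namespace ColimitComputation

variable (P : ColimitComputation (PolyModBasic k n))

theorem ncard_edges_le_size : (P.shape 0).edges.ncard ≤ P.size := Nat.le_add_left _ _

theorem ncard_verts_le : (P.shape 0).verts.ncard ≤ 2 * P.size := by
  have hsub : (P.shape 0).verts ⊆
      (fun e => e.left) '' (P.shape 0).edges ∪ (fun e => e.right) '' (P.shape 0).edges := by
    intro a ha
    obtain ⟨e, he, h | h⟩ := P.no_isolated a ha
    · exact Or.inl ⟨e, he, h⟩
    · exact Or.inr ⟨e, he, h⟩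
  have h1 := Set.ncard_le_ncard hsub (Set.toFinite _)
  have h2 := Set.ncard_union_le ((fun e => e.left) '' (P.shape 0).edges)
    ((fun e => e.right) '' (P.shape 0).edges)
  have h3 := Set.ncard_image_le (f := fun e : Quiver.Total P.V => e.left)
    (Set.toFinite (P.shape 0).edges)
  have h4 := Set.ncard_image_le (f := fun e : Quiver.Total P.V => e.right)
    (Set.toFinite (P.shape 0).edges)
  have h5 := P.ncard_edges_le_size
  omega

theorem one_le_size_of_mem {a : P.V} (ha : a ∈ (P.shape 0).verts) : 1 ≤ P.size := by
  obtain ⟨e, he, -⟩ := P.no_isolated a ha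
  exact ((Set.ncard_pos (Set.toFinite _)).2 ⟨e, he⟩).trans_le P.ncard_edges_le_size

theorem exists_isStdPresented_obj :
    ∃ z : P.V → Fin 2 → MvPolynomial (Fin n) k,
      ∀ a ∈ (P.shape 0).verts, IsStdPresented (P.diagram.obj a) (z a) := by
  have h : ∀ a, ∃ z : Fin 2 → MvPolynomial (Fin n) k,
      a ∈ (P.shape 0).verts → IsStdPresented (P.diagram.obj a) z := by
    intro a
    by_cases ha : a ∈ (P.shape 0).verts
    · obtain ⟨e, he, rfl | rfl⟩ := P.no_isolated a ha
      · exact (P.basic e he).exists_isStdPresented.1.imp fun _ h _ => h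
      · exact (P.basic e he).exists_isStdPresented.2.imp fun _ h _ => h
    · exact ⟨0, fun h => absurd h ha⟩
  choose z hz using h
  exact ⟨z, hz⟩

/-- Each basic morphism involves at most one variable, so there are at most as many variables as
edges. -/
theorem exists_edge_matrix :
    ∃ (I : Finset (Fin n)) (a : Quiver.Total P.V → Fin 2 → Fin 2 → MvPolynomial (Fin n) k),
      I.card ≤ P.size ∧ (∀ e i j, a e i j ∈ affineForms k I) ∧
      ∀ e ∈ (P.shape 0).edges, ∀ i, (P.diagram.map e.hom).hom (stdGen _ i) =
        ∑ j, a e i j • stdGen _ j := by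
  classical
  have h : ∀ e : Quiver.Total P.V, ∃ (I : Finset (Fin n))
      (a : Fin 2 → Fin 2 → MvPolynomial (Fin n) k), I.card ≤ 1 ∧
      (∀ i j, a i j ∈ affineForms k I) ∧ (e ∈ (P.shape 0).edges →
        ∀ i, (P.diagram.map e.hom).hom (stdGen _ i) = ∑ j, a i j • stdGen _ j) := by
    intro e
    by_cases he : e ∈ (P.shape 0).edges
    · obtain ⟨I, hI, a, ha, h⟩ := (P.basic e he).exists_matrix
      exact ⟨I, a, hI, ha, fun _ => h⟩
    · exact ⟨∅, 0, by simp, fun _ _ => Submodule.zero_mem _, fun h => absurd h he⟩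
  choose I a hI ha h using h
  have hE := Set.toFinite (P.shape 0).edges
  refine ⟨hE.toFinset.biUnion I, fun e => if e ∈ (P.shape 0).edges then a e else 0, ?_, ?_, ?_⟩
  · refine (Finset.card_biUnion_le_card_mul _ _ 1 fun e _ => hI e).trans ?_
    rw [mul_one, ← Set.ncard_eq_toFinset_card _ hE]
    exact P.ncard_edges_le_size
  · intro e i j
    beta_reduce
    split_ifs with he
    · exact affineForms_mono (Finset.subset_biUnion_of_mem I (hE.mem_toFinset.2 he)) (ha e i j)
    · exact Submodule.zero_mem _
  · intro e he i
    beta_reduce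
    rw [if_pos he]
    exact h e he i

/-- The subgraph with a single vertex and no edges. -/
def vertexSub (a : P.V) : DiSubgraph P.V where
  verts := {a}
  edges := ∅
  left_mem _ h := h.elim
  right_mem _ h := h.elim

/-- The identity cocone on a single vertex. -/
noncomputable def vertexLeg (a : P.V) (b : (P.vertexSub a).verts) : P.diagram.obj b.1 ⟶ P.diagram.obj a :=
  eqToHom (congrArg P.diagram.obj b.2)

theorem isColimitOn_vertexSub (a : P.V) :
    IsColimitOn P.diagram (P.vertexSub a) (P.diagram.obj a) (P.vertexLeg a) := by
  refine ⟨fun e he => he.elim, fun X ψ _ => ⟨ψ ⟨a, rfl⟩, ?_, fun t ht => ?_⟩⟩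
  · rintro ⟨b, rfl⟩
    exact Category.id_comp _
  · exact (Category.id_comp t).symm.trans (ht ⟨a, rfl⟩)

theorem range_eq_span_of_isStdPresented {X Y : ModuleCat.{w} (MvPolynomial (Fin n) k)}
    {z : Fin 2 → MvPolynomial (Fin n) k} (hX : IsStdPresented X z) (f : X ⟶ Y) :
    LinearMap.range f.hom = Submodule.span (MvPolynomial (Fin n) k)
      (Set.range fun i => f.hom (stdGen X i)) := by
  rw [LinearMap.range_eq_map, ← hX.span_eq_top, Submodule.map_span, ← Set.range_comp]
  rfl

theorem card_verts_mul_two_le {J : DiSubgraph P.V} [Fintype J.verts] (h : J ≤ P.shape 0) :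
    Fintype.card (J.verts × Fin 2) ≤ 4 * P.size := by
  have h1 := Set.ncard_le_ncard h.1 (Set.toFinite _)
  have h2 := P.ncard_verts_le
  rw [Fintype.card_prod, Fintype.card_fin, ← Nat.card_eq_fintype_card, Nat.card_coe_set_eq]
  omega

/-- Every edge is basic or a leg. A basic edge gives the two rows of its matrix, with the target
seen as a colimit over one vertex. A leg from a basic vertex gives two of the generators of its
apex. A leg from an earlier apex gives the images of the generators of that apex, which are again
generators of the later apex because the legs compose. -/
theorem exists_image_generators {I : Finset (Fin n)}
    {a : Quiver.Total P.V → Fin 2 → Fin 2 → MvPolynomial (Fin n) k}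
    (haI : ∀ e i j, a e i j ∈ affineForms k I)
    (ha : ∀ e ∈ (P.shape 0).edges, ∀ i, (P.diagram.map e.hom).hom (stdGen _ i) =
        ∑ j, a e i j • stdGen _ j) (e : Quiver.Total P.V) :
    ∃ (J : DiSubgraph P.V) (leg : ∀ b : J.verts, P.diagram.obj b.1 ⟶ P.diagram.obj e.right)
      (_ : Fintype J.verts) (Im : Type) (_ : Fintype Im)
      (L : Im → J.verts × Fin 2 → MvPolynomial (Fin n) k),
      J ≤ P.shape 0 ∧ IsColimitOn P.diagram J (P.diagram.obj e.right) leg ∧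
      Fintype.card Im ≤ 4 * P.size ∧ (∀ i g, L i g ∈ affineForms k I) ∧
      LinearMap.range (P.diagram.map e.hom).hom = Submodule.span (MvPolynomial (Fin n) k)
        (Set.range fun i => ∑ g, L i g • apexGen leg g) := by
  classical
  obtain ⟨z, hz⟩ := P.exists_isStdPresented_obj
  have hsingle : ∀ {J : DiSubgraph P.V} [Fintype J.verts] (p g : J.verts × Fin 2),
      (Pi.single p 1 : J.verts × Fin 2 → MvPolynomial (Fin n) k) g ∈ affineForms k I := by
    intro J _ p g
    rw [Pi.single_apply]
    split_ifs
    · exact one_mem_affineForms I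
    · exact Submodule.zero_mem _
  have hsum : ∀ {J : DiSubgraph P.V} [Fintype J.verts] {W : ModuleCat.{w} (MvPolynomial (Fin n) k)}
      (x : J.verts × Fin 2 → W) (p : J.verts × Fin 2),
      ∑ g, (Pi.single p 1 : J.verts × Fin 2 → MvPolynomial (Fin n) k) g • x g = x p := by
    intro J _ W x p
    rw [Finset.sum_eq_single p]
    · simp
    · intro g _ hg
      simp [hg]
    · simp
  rcases P.mem_shape_edges (i := Fin.last P.steps) (e := e)
    (by rw [P.shape_last_edges]; trivial) with he | ⟨l, -, b, rfl⟩
  · have hl := (P.shape 0).left_mem e he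
    have hr := (P.shape 0).right_mem e he
    let _ : Fintype (P.vertexSub e.right).verts := Fintype.ofFinite _
    refine ⟨P.vertexSub e.right, P.vertexLeg e.right, inferInstance, Fin 2, inferInstance,
      fun i g => a e i g.2, ?_, P.isColimitOn_vertexSub _, ?_, fun i g => haI _ _ _, ?_⟩
    · exact ⟨Set.singleton_subset_iff.2 hr, Set.empty_subset _⟩
    · have := P.one_le_size_of_mem hl
      rw [Fintype.card_fin]
      omega
    · rw [range_eq_span_of_isStdPresented (hz _ hl)]
      congr 1
      congr 1
      funext i
      rw [ha e he i, Fintype.sum_prod_type]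
      rw [Fintype.sum_eq_single (⟨e.right, rfl⟩ : (P.vertexSub e.right).verts)
        fun b hb => absurd (Subtype.ext (show b.1 = e.right from b.2)) hb]
      rfl
  · have hsub : P.basicSub l ≤ P.shape 0 := ⟨Set.inter_subset_right, Set.inter_subset_right⟩
    let _ : Fintype (P.basicSub l).verts := Fintype.ofFinite _
    rcases P.mem_shape_verts ((P.sub_full l).1.1 b.2) with h0 | ⟨m, -, hm⟩
    · refine ⟨P.basicSub l, P.basicLeg l, inferInstance, Fin 2, inferInstance,
        fun i => Pi.single (⟨b.1, b.2, h0⟩, i) 1, hsub, P.isColimitOn_basicSub l, ?_,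
        fun i g => hsingle _ _, ?_⟩
      · have := P.one_le_size_of_mem h0
        rw [Fintype.card_fin]
        omega
      · refine (range_eq_span_of_isStdPresented (hz _ h0) _).trans ?_
        congr 1
        congr 1
        funext i
        rw [hsum]
        rfl
    · obtain ⟨b, hb⟩ := b
      obtain rfl : b = P.apex m := hm
      let _ : Fintype (P.basicSub m).verts := Fintype.ofFinite _
      have hsub' : P.basicSub m ≤ P.shape 0 := ⟨Set.inter_subset_right, Set.inter_subset_right⟩
      have hmem : ∀ c : (P.basicSub m).verts, c.1 ∈ (P.basicSub l).verts :=
        fun c => ⟨(P.sub_le_sub hb).1 c.2.1, c.2.2⟩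
      refine ⟨P.basicSub l, P.basicLeg l, inferInstance, (P.basicSub m).verts × Fin 2,
        inferInstance, fun p => Pi.single (⟨p.1.1, hmem p.1⟩, p.2) 1, hsub,
        P.isColimitOn_basicSub l, P.card_verts_mul_two_le hsub', fun i g => hsingle _ _, ?_⟩
      have h1 := surjective_apexGen (P.isColimitOn_basicSub m) (fun c => hz c.1 c.2.2)
      rw [← LinearMap.range_eq_top, Fintype.range_linearCombination] at h1
      rw [LinearMap.range_eq_map]
      refine (congrArg (Submodule.map _) h1.symm).trans ?_
      rw [Submodule.map_span, ← Set.range_comp]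
      congr 1
      congr 1
      funext p
      rw [hsum]
      exact congrArg (fun f => f.hom (stdGen _ p.2))
        (P.map_leg_comp_map_leg hb ⟨p.1.1, p.1.2.1⟩)

/-- There are two generators for each of at most 2s vertices; one relation for each generator and
two for each of at most s edges give 6s. -/
theorem exists_presentation (e : Quiver.Total P.V) :
    ∃ (I : Finset (Fin n)) (Gen Rel Im : Type) (_ : Fintype Gen) (_ : Fintype Rel)
      (_ : Fintype Im) (x : Gen → P.diagram.obj e.right)
      (rel : Rel → Gen → MvPolynomial (Fin n) k) (L : Im → Gen → MvPolynomial (Fin n) k),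
      I.card ≤ P.size ∧ Fintype.card Gen ≤ 4 * P.size ∧ Fintype.card Rel ≤ 6 * P.size ∧
      Fintype.card Im ≤ 4 * P.size ∧ (∀ r g, rel r g ∈ affineForms k I) ∧
      (∀ i g, L i g ∈ affineForms k I) ∧
      Function.Surjective (Fintype.linearCombination (MvPolynomial (Fin n) k) x) ∧
      LinearMap.ker (Fintype.linearCombination (MvPolynomial (Fin n) k) x) =
        Submodule.span (MvPolynomial (Fin n) k) (Set.range rel) ∧
      LinearMap.range (P.diagram.map e.hom).hom = Submodule.span (MvPolynomial (Fin n) k)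
        (Set.range fun i => ∑ g, L i g • x g) := by
  classical
  obtain ⟨z, hz⟩ := P.exists_isStdPresented_obj
  obtain ⟨I, a, hI, haI, ha⟩ := P.exists_edge_matrix
  obtain ⟨J, leg, _, Im, _, L, hJ, hcolim, hIm, hL, hrange⟩ := P.exists_image_generators haI ha e
  let _ : Fintype J.edges := Fintype.ofFinite _
  have hz' : ∀ b : J.verts, IsStdPresented (P.diagram.obj b.1) (z b.1) := fun b =>
    hz b.1 (hJ.1 b.2)
  refine ⟨I, J.verts × Fin 2, (J.verts × Fin 2) ⊕ (J.edges × Fin 2), Im, inferInstance,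
    inferInstance, inferInstance, apexGen leg, apexRel J (fun b => z b.1) (fun e => a e.1), L, hI,
    P.card_verts_mul_two_le hJ, ?_, hIm, ?_, hL, surjective_apexGen hcolim hz',
    ker_apexGen hcolim hz' (fun e => ha e.1 (hJ.2 e.2)), hrange⟩
  · have h1 := P.card_verts_mul_two_le hJ
    have h2 := Set.ncard_le_ncard hJ.2 (Set.toFinite _)
    have h3 := P.ncard_edges_le_size
    rw [Fintype.card_sum, Fintype.card_prod J.edges, Fintype.card_fin,
      ← Nat.card_eq_fintype_card (α := J.edges), Nat.card_coe_set_eq]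
    omega
  · have hsingle : ∀ (p g : J.verts × Fin 2) (r : MvPolynomial (Fin n) k), r ∈ affineForms k I →
        (Pi.single p r : J.verts × Fin 2 → MvPolynomial (Fin n) k) g ∈ affineForms k I := by
      intro p g r hr
      rw [Pi.single_apply]
      split_ifs
      · exact hr
      · exact Submodule.zero_mem _
    rintro (p | ⟨e, i⟩) g
    · refine hsingle _ _ _ ?_
      rcases (hz' p.1).zero_or_one p.2 with h | h
      · exact Set.mem_of_eq_of_mem h (Submodule.zero_mem _)
      · exact Set.mem_of_eq_of_mem h (one_mem_affineForms I)
    · rw [apexRel, Pi.sub_apply, Finset.sum_apply]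
      exact Submodule.sub_mem _ (hsingle _ _ _ (one_mem_affineForms I))
        (Submodule.sum_mem _ fun j _ => hsingle _ _ _ (haI _ _ _))

end ColimitComputation

end Data

/-! ### From presentations to matrices, and the final bound. -/

section Main

variable {k : Type w} [Field k] {n : ℕ}

theorem exists_eq_of_mem_affineForms {I : Finset (Fin n)} {r : MvPolynomial (Fin n) k}
    (h : r ∈ affineForms k I) : ∃ c : Option (Fin I.card) → k,
      r = MvPolynomial.C (c none) +
        ∑ l, MvPolynomial.C (c (some l)) * MvPolynomial.X (I.orderEmbOfFin rfl l) := by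
  classical
  induction h using Submodule.span_induction with
  | mem r hr =>
    rcases hr with rfl | ⟨i, hi, rfl⟩
    · exact ⟨fun o => o.elim 1 fun _ => 0, by simp⟩
    · obtain ⟨l, rfl⟩ : i ∈ Set.range (I.orderEmbOfFin rfl) := by
        rw [Finset.range_orderEmbOfFin]
        exact hi
      refine ⟨fun o => o.elim 0 fun l' => if l' = l then 1 else 0, ?_⟩
      simp [apply_ite MvPolynomial.C, ite_mul]
  | zero => exact ⟨0, by simp⟩
  | add r s _ _ hr hs =>
    obtain ⟨c, rfl⟩ := hr
    obtain ⟨d, rfl⟩ := hs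
    refine ⟨c + d, ?_⟩
    simp only [Pi.add_apply, map_add, add_mul, Finset.sum_add_distrib]
    ring
  | smul a r _ hr =>
    obtain ⟨c, rfl⟩ := hr
    refine ⟨a • c, ?_⟩
    simp only [Pi.smul_apply, smul_eq_mul, map_mul, MvPolynomial.smul_eq_C_mul, mul_add,
      Finset.mul_sum, mul_assoc]

theorem linearCombination_comp_equiv {R N α β : Type*} [CommRing R] [AddCommGroup N] [Module R N]
    [Fintype α] [Fintype β] (ε : α ≃ β) (x : α → N) (v : β → R) :
    Fintype.linearCombination R (x ∘ ε.symm) v = Fintype.linearCombination R x (v ∘ ε) := by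
  rw [Fintype.linearCombination_apply, Fintype.linearCombination_apply]
  exact Fintype.sum_equiv ε.symm _ _ fun b => by simp

theorem ker_linearCombination_comp_equiv {R N α β ι : Type*} [CommRing R] [AddCommGroup N]
    [Module R N] [Fintype α] [Fintype β] (ε : α ≃ β) (x : α → N) {rel : ι → α → R}
    (h : LinearMap.ker (Fintype.linearCombination R x) = Submodule.span R (Set.range rel)) :
    LinearMap.ker (Fintype.linearCombination R (x ∘ ε.symm)) =
      Submodule.span R (Set.range fun i => rel i ∘ ε.symm) := by
  apply le_antisymm
  · intro v hv
    have h1 : v ∘ ε ∈ LinearMap.ker (Fintype.linearCombination R x) := by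
      rw [LinearMap.mem_ker, ← linearCombination_comp_equiv]
      exact hv
    rw [h] at h1
    have h2 := Submodule.mem_map_of_mem (f := LinearMap.funLeft R R ε.symm) h1
    rw [Submodule.map_span, ← Set.range_comp] at h2
    have h3 : LinearMap.funLeft R R ε.symm (v ∘ ε) = v := by
      funext b
      simp [LinearMap.funLeft_apply]
    rwa [h3] at h2
  · rw [Submodule.span_le]
    rintro _ ⟨i, rfl⟩
    rw [SetLike.mem_coe, LinearMap.mem_ker, linearCombination_comp_equiv]
    have h1 : rel i ∈ LinearMap.ker (Fintype.linearCombination R x) := by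
      rw [h]
      exact Submodule.subset_span ⟨i, rfl⟩
    have h2 : (rel i ∘ ε.symm) ∘ ε = rel i := by
      funext a
      simp
    rw [h2]
    exact h1

theorem exists_bound_of_affine_presentation (m p q l : ℕ) :
    ∃ b : ℕ, ∀ (k : Type w) [Field k] (n : ℕ) (M N : ModuleCat.{w} (MvPolynomial (Fin n) k))
      (φ : M ⟶ N) (I : Finset (Fin n)) (Gen Rel Im : Type) [Fintype Gen] [Fintype Rel]
      [Fintype Im] (x : Gen → N) (rel : Rel → Gen → MvPolynomial (Fin n) k)
      (L : Im → Gen → MvPolynomial (Fin n) k), I.card = m → Fintype.card Gen = p →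
      Fintype.card Im = q → Fintype.card Rel = l → (∀ r g, rel r g ∈ affineForms k I) →
      (∀ i g, L i g ∈ affineForms k I) →
      Function.Surjective (Fintype.linearCombination (MvPolynomial (Fin n) k) x) →
      LinearMap.ker (Fintype.linearCombination (MvPolynomial (Fin n) k) x) =
        Submodule.span (MvPolynomial (Fin n) k) (Set.range rel) →
      LinearMap.range φ.hom = Submodule.span (MvPolynomial (Fin n) k)
        (Set.range fun i => ∑ g, L i g • x g) →
      ∃ Q : ColimitComputation (PolyModBasic k n),
        Q.Computes (morphismDiagram (ModuleCat.ofHom (LinearMap.range φ.hom).subtype)) ∧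
        Q.size ≤ b := by
  classical
  obtain ⟨b, hb⟩ := exists_bound_of_presentation.{w} m p q l
  refine ⟨b, ?_⟩
  intro k _ n M N φ I Gen Rel Im _ _ _ x rel L hm hp hq hl hrelI hLI hsurj hker hrange
  subst hm
  let εG := Fintype.equivFinOfCardEq hp
  let εR := Fintype.equivFinOfCardEq hl
  let εI := Fintype.equivFinOfCardEq hq
  -- The generators of the image fill the first q columns and the relations the last l.
  let B : Fin p → Fin (q + l) → MvPolynomial (Fin n) k := fun i j =>
    Fin.addCases (motive := fun _ => MvPolynomial (Fin n) k)
      (fun a => L (εI.symm a) (εG.symm i)) (fun r => rel (εR.symm r) (εG.symm i)) j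
  have hB : ∀ i j, B i j ∈ affineForms k I := by
    intro i j
    refine Fin.addCases (fun a => ?_) (fun r => ?_) j
    · simp only [B, Fin.addCases_left]
      exact hLI _ _
    · simp only [B, Fin.addCases_right]
      exact hrelI _ _
  choose c hc using fun i j => exists_eq_of_mem_affineForms (hB i j)
  have hval : ∀ i j, LinearTerm.scalarEval
      (scalars (fun t : Fin p × Fin (q + l) × Option (Fin I.card) => c t.1 t.2.1 t.2.2)
        (I.orderEmbOfFin rfl)) (affineMatrix I.card p (q + l) i j) = B i j := fun i j =>
    (scalarEval_affineMatrix _ _ i j).trans (hc i j).symm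
  refine hb k n M N φ (fun t => c t.1 t.2.1 t.2.2) (I.orderEmbOfFin rfl) (x ∘ εG.symm)
    (I.orderEmbOfFin rfl).injective ?_ ?_ ?_
  · intro y
    obtain ⟨v, rfl⟩ := hsurj y
    refine ⟨v ∘ εG.symm, ?_⟩
    rw [linearCombination_comp_equiv]
    congr 1
    funext a
    simp
  · simp only [hval]
    rw [ker_linearCombination_comp_equiv εG x hker]
    congr 1
    rw [← εR.symm.surjective.range_comp]
    congr 1
    funext r i
    simp [B]
  · simp only [hval]
    rw [hrange]
    congr 1
    rw [← εI.symm.surjective.range_comp]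
    congr 1
    funext a
    simp only [B, Fin.addCases_left, Function.comp_apply]
    exact (Fintype.sum_equiv εG.symm _ _ fun i => rfl).symm

end Main

theorem mainTheorem11 :
    ∃ bound : ℕ → ℕ,
      ∀ (k : Type w) [Field k] (n : ℕ) (M N : ModuleCat.{w} (MvPolynomial (Fin n) k)) (φ : M ⟶ N)
        (P : ColimitComputation (PolyModBasic k n)),
        P.Computes (morphismDiagram φ) →
        ∃ Q : ColimitComputation (PolyModBasic k n),
          Q.Computes (morphismDiagram (ModuleCat.ofHom (LinearMap.range φ.hom).subtype)) ∧
          Q.size ≤ bound P.size := by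
  choose b hb using exists_bound_of_affine_presentation.{w}
  -- The maximum over all formats with m ≤ s, p ≤ 4s, q ≤ 4s and l ≤ 6s.
  refine ⟨fun s => (Finset.range (s + 1) ×ˢ Finset.range (4 * s + 1) ×ˢ Finset.range (4 * s + 1) ×ˢ
    Finset.range (6 * s + 1)).sup fun t => b t.1 t.2.1 t.2.2.1 t.2.2.2, ?_⟩
  rintro k _ n M N φ P ⟨g, -, -, α, hα⟩
  obtain ⟨I, Gen, Rel, Im, _, _, _, x, rel, L, hI, hGen, hRel, hIm, hrelI, hLI, hsurj, hker,
    hrange⟩ := P.exists_presentation ⟨_, _, g.map ArrowGraph.Edge.edge⟩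
  let β : N ≅ P.diagram.obj (g.obj .target) := α .target
  let γ : M ≅ P.diagram.obj (g.obj .source) := α .source
  have hβ : φ ≫ β.hom = γ.hom ≫ P.diagram.map (g.map ArrowGraph.Edge.edge) :=
    hα .source .target .edge
  have hcomb : ∀ v, Fintype.linearCombination (MvPolynomial (Fin n) k)
      (fun i => β.inv.hom (x i)) v =
      β.inv.hom (Fintype.linearCombination (MvPolynomial (Fin n) k) x v) := by
    intro v
    rw [Fintype.linearCombination_apply, Fintype.linearCombination_apply, map_sum]
    exact Finset.sum_congr rfl fun i _ => (map_smul _ _ _).symm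
  have hinv : ∀ y, β.hom.hom (β.inv.hom y) = y := fun y =>
    congrArg (fun f => f.hom y) β.inv_hom_id
  have hinv' : ∀ y, β.inv.hom (β.hom.hom y) = y := fun y =>
    congrArg (fun f => f.hom y) β.hom_inv_id
  obtain ⟨Q, hQ, hsize⟩ := hb I.card (Fintype.card Gen) (Fintype.card Im) (Fintype.card Rel)
    k n M N φ I Gen Rel Im (fun i => β.inv.hom (x i)) rel L rfl rfl rfl rfl hrelI hLI
    (fun y => by
      obtain ⟨v, hv⟩ := hsurj (β.hom.hom y)
      exact ⟨v, by rw [hcomb, hv, hinv']⟩)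
    (by
      rw [← hker]
      ext v
      rw [LinearMap.mem_ker, LinearMap.mem_ker, hcomb]
      constructor
      · intro h
        rw [← hinv (Fintype.linearCombination _ x v), h, map_zero]
      · intro h
        rw [h, map_zero])
    (by
      have h1 : LinearMap.range φ.hom = Submodule.map β.inv.hom
          (LinearMap.range (P.diagram.map (g.map ArrowGraph.Edge.edge)).hom) := by
        have h2 : φ = γ.hom ≫ P.diagram.map (g.map ArrowGraph.Edge.edge) ≫ β.inv := by
          rw [← Category.assoc, ← hβ, Category.assoc, β.hom_inv_id, Category.comp_id]
        have h3 : Function.Surjective γ.hom.hom := fun y =>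
          ⟨γ.inv.hom y, congrArg (fun f => f.hom y) γ.inv_hom_id⟩
        rw [h2, ← LinearMap.range_comp]
        exact LinearMap.range_comp_of_range_eq_top
          (f := γ.hom.hom) _ (LinearMap.range_eq_top.2 h3)
      rw [h1, hrange, Submodule.map_span, ← Set.range_comp]
      congr 1
      congr 1
      funext i
      change β.inv.hom (∑ g, L i g • x g) = _
      rw [map_sum]
      exact Finset.sum_congr rfl fun i _ => map_smul _ _ _)
  refine ⟨Q, hQ, hsize.trans ?_⟩
  refine Finset.le_sup (f := fun t : ℕ × ℕ × ℕ × ℕ => b t.1 t.2.1 t.2.2.1 t.2.2.2)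
    (b := (I.card, Fintype.card Gen, Fintype.card Im, Fintype.card Rel)) ?_
  simp only [Finset.mem_product, Finset.mem_range]
  omega
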